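/- Let $\mathcal U,\mathcal V$ be finite non-empty sets, $\mathcal P_U$ a probability distribution on $\mathcal U$, and $c_1,c_2,c_3:\mathcal U\times\mathcal V\to\mathbb R$ the cost functions of an encoder, a relay and a decoder. Let $R_1,R_2\ge 0$. For a block length $n\ge 1$, strategies are stochastic maps $$\sigma:\mathcal U^n\to\Delta(\{1,\dots,2^{\lfloor nR_1\rfloor}\}),\quad \mu:\{1,\dots,2^{\lfloor nR_1\rfloor}\}\to\Delta(\{1,\dots,2^{\lfloor nR_2\rfloor}\}),\quad \tau:\{1,\dots,2^{\lfloor nR_2\rfloor}\}\to\Delta(\mathcal V^n),$$ which induce the law $\prod_t\mathcal P_U(u_t)\,\sigma(m_1|u^n)\,\mu(m_2|m_1)\,\tau(v^n|m_2)$ and the long-run costs $c_i^n(\sigma,\mu,\tau)=\mathbb E\big[\frac1n\sum_{t=1}^n c_i(U_t,V_t)\big]$. Let $\mathbb A_3(\sigma,\mu)=\arg\min_\tau c_3^n(\sigma,\mu,\tau)$, let $\mathbb A_2(\sigma)$ be the set of minimizers of $c_2^n(\sigma,\mu,\tau)$ over the pairs $(\mu,\tau)$ with $\tau\in\mathbb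 A_3(\sigma,\mu)$, and $$\Gamma_e^n(R_1,R_2)=\inf_\sigma\max_{(\mu,\tau)\in\mathbb A_2(\sigma)}c_1^n(\sigma,\mu,\tau).$$ Let $\mathcal W$ be a finite set with $|\mathcal W|\ge\min(|\mathcal U|+1,|\mathcal V|)$ and define $$\Gamma_e^c(R_1,R_2)=\inf_{\mathcal Q_{W|U}:\ \min(R_1,R_2)\ge I(U;W)}\ \max_{\mathcal Q_{V|W}\in\arg\min\mathbb E[c_3(U,V)]}\mathbb E[c_1(U,V)],$$ where $W$ takes values in $\mathcal W$, $(U,W,V)$ has law $\mathcal P_U\mathcal Q_{W|U}\mathcal Q_{V|W}$ and mutual information is measured in bits. If $c_1=c_2=c_3$, then all these maxima are attained, the infima are finite, and $$\lim_{n\to\infty}\Gamma_e^n(R_1,R_2)=\inf_{n\ge 1}\Gamma_e^n(R_1,R_2)=\Gamma_e^c(R_1,R_2).$$ -/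

import Mathlib

open Filter Topology

noncomputable section

namespace CascadeCoding

/-- A channel (stochastic map) from `A` to the finite set `B`: for every input, a probability
distribution on `B`. -/
abbrev Channel (A B : Type*) [Fintype B] : Type _ := A → stdSimplex ℝ B

/-- The message set of cardinality `2 ^ ⌊n R⌋`. -/
abbrev Msg (n : ℕ) (R : ℝ) : Type := Fin (2 ^ ⌊(n : ℝ) * R⌋₊)

/-- Strategies `σ` of the encoder. -/
abbrev EncStrat (U : Type*) (n : ℕ) (R₁ : ℝ) : Type _ :=
  Channel (Fin n → U) (Msg n R₁)

/-- Strategies `μ` of the relay. -/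
abbrev RelayStrat (n : ℕ) (R₁ R₂ : ℝ) : Type _ :=
  Channel (Msg n R₁) (Msg n R₂)

/-- Strategies `τ` of the decoder. -/
abbrev DecStrat (V : Type*) [Fintype V] (n : ℕ) (R₂ : ℝ) : Type _ :=
  Channel (Msg n R₂) (Fin n → V)

section MultiLetter

variable {U V : Type*} [Fintype U] [Fintype V] {n : ℕ} {R₁ R₂ : ℝ}

/-- The joint distribution of `(U^n, M₁, M₂, V^n)` induced by the strategies. -/
def jointLaw (P : stdSimplex ℝ U) (σ : EncStrat U n R₁) (μ : RelayStrat n R₁ R₂)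
    (τ : DecStrat V n R₂) (u : Fin n → U) (m₁ : Msg n R₁) (m₂ : Msg n R₂) (v : Fin n → V) : ℝ :=
  (∏ t, P.1 (u t)) * (σ u).1 m₁ * (μ m₁).1 m₂ * (τ m₂).1 v

/-- The marginal distribution of `(U^n, V^n)`. -/
def lawUV (P : stdSimplex ℝ U) (σ : EncStrat U n R₁) (μ : RelayStrat n R₁ R₂)
    (τ : DecStrat V n R₂) (u : Fin n → U) (v : Fin n → V) : ℝ :=
  ∑ m₁, ∑ m₂, jointLaw P σ μ τ u m₁ m₂ v

/-- The long-run cost `E[(1/n) ∑ₜ c(Uₜ, Vₜ)]`. -/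
def longRunCost (P : stdSimplex ℝ U) (c : U → V → ℝ) (σ : EncStrat U n R₁)
    (μ : RelayStrat n R₁ R₂) (τ : DecStrat V n R₂) : ℝ :=
  ∑ u : Fin n → U, ∑ v : Fin n → V, lawUV P σ μ τ u v * (1 / (n : ℝ) * ∑ t, c (u t) (v t))

/-- Best responses of the decoder to `(σ, μ)`: the minimizers over `τ` of its long-run cost. -/
def decoderBR (P : stdSimplex ℝ U) (c₃ : U → V → ℝ) (σ : EncStrat U n R₁)
    (μ : RelayStrat n R₁ R₂) : Set (DecStrat V n R₂) :=
  {τ | ∀ τ', longRunCost P c₃ σ μ τ ≤ longRunCost P c₃ σ μ τ'}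

/-- Best responses of the relay to `σ`: the minimizers of its long-run cost over the pairs `(μ, τ)`
in which `τ` is a best response of the decoder to `(σ, μ)`. -/
def relayBR (P : stdSimplex ℝ U) (c₂ c₃ : U → V → ℝ) (σ : EncStrat U n R₁) :
    Set (RelayStrat n R₁ R₂ × DecStrat V n R₂) :=
  {p | p.2 ∈ decoderBR P c₃ σ p.1 ∧
    ∀ q : RelayStrat n R₁ R₂ × DecStrat V n R₂, q.2 ∈ decoderBR P c₃ σ q.1 →
      longRunCost P c₂ σ p.1 p.2 ≤ longRunCost P c₂ σ q.1 q.2}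

variable (R₂) in
/-- The encoder's long-run costs over the best responses of the relay and the decoder to `σ`. -/
def encoderCosts (P : stdSimplex ℝ U) (c₁ c₂ c₃ : U → V → ℝ) (σ : EncStrat U n R₁) : Set ℝ :=
  (fun p : RelayStrat n R₁ R₂ × DecStrat V n R₂ => longRunCost P c₁ σ p.1 p.2) ''
    relayBR P c₂ c₃ σ

variable (R₂) in
/-- The encoder's worst-case long-run cost when it commits to `σ`. -/
def worstCost (P : stdSimplex ℝ U) (c₁ c₂ c₃ : U → V → ℝ) (σ : EncStrat U n R₁) : ℝ :=
  sSup (encoderCosts R₂ P c₁ c₂ c₃ σ)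

/-- The encoder's optimal cost `Γₑⁿ(R₁, R₂)` at block length `n`. -/
def gammaN (P : stdSimplex ℝ U) (c₁ c₂ c₃ : U → V → ℝ) (R₁ R₂ : ℝ) (n : ℕ) : ℝ :=
  sInf (Set.range fun σ : EncStrat U n R₁ => worstCost R₂ P c₁ c₂ c₃ σ)

end MultiLetter

section SingleLetter

variable {U V W : Type*} [Fintype U] [Fintype V] [Fintype W]

/-- The mutual information `I(U; W)` in bits, for `U ∼ P` and `W` drawn from `U` through `Q`. -/
def mutualInfo (P : stdSimplex ℝ U) (Q : Channel U W) : ℝ :=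
  ∑ u, ∑ w, P.1 u * (Q u).1 w * Real.logb 2 ((Q u).1 w / ∑ u', P.1 u' * (Q u').1 w)

variable (W) in
/-- The target distributions `Q_{W|U}` with `min(R₁, R₂) ≥ I(U; W)`. -/
def targets (P : stdSimplex ℝ U) (R₁ R₂ : ℝ) : Set (Channel U W) :=
  {Q | min R₁ R₂ ≥ mutualInfo P Q}

/-- The expectation of `c(U, V)` for `(U, W, V) ∼ P Q_{W|U} T_{V|W}`. -/
def expCost (P : stdSimplex ℝ U) (c : U → V → ℝ) (Q : Channel U W) (T : Channel W V) : ℝ :=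
  ∑ u, ∑ w, ∑ v, P.1 u * (Q u).1 w * (T w).1 v * c u v

/-- The single-letter best responses `Q_{V|W}` of the decoder. -/
def singleBR (P : stdSimplex ℝ U) (c₃ : U → V → ℝ) (Q : Channel U W) : Set (Channel W V) :=
  {T | ∀ T', expCost P c₃ Q T ≤ expCost P c₃ Q T'}

/-- The encoder's expected costs over the single-letter best responses of the decoder. -/
def singleCosts (P : stdSimplex ℝ U) (c₁ c₃ : U → V → ℝ) (Q : Channel U W) : Set ℝ :=
  (fun T => expCost P c₁ Q T) '' singleBR P c₃ Q

/-- The encoder's worst-case single-letter cost. -/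
def singleWorst (P : stdSimplex ℝ U) (c₁ c₃ : U → V → ℝ) (Q : Channel U W) : ℝ :=
  sSup (singleCosts P c₁ c₃ Q)

variable (W) in
/-- The single-letter optimal cost `Γₑᶜ(R₁, R₂)` of the encoder, with auxiliary alphabet `W`. -/
def gammaC (P : stdSimplex ℝ U) (c₁ c₃ : U → V → ℝ) (R₁ R₂ : ℝ) : ℝ :=
  sInf ((fun Q => singleWorst P c₁ c₃ Q) '' targets W P R₁ R₂)

end SingleLetter

end CascadeCoding

end

noncomputable section

namespace CascadeCoding

/-! With equal costs the three players form a team. A joint minimizer over relay and decoder is a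
best response of both, all best responses give the encoder the same cost, and `gammaN` is the
infimum of the long-run cost over all codes. What remains is lossy source coding over a cascade
whose rate is that of the slower link.

Converse: merging the relay with the encoder or the decoder leaves a point-to-point code using only
the slower link. Averaging its letter-pair law over time gives a test channel from `U` to `V` with
the same cost and no more information than the link carries (`exists_singleLetter_channel`). Its
output serves as the auxiliary variable, after reduction to `|U| + 1` letters if necessary
(`exists_channel_small_support`). Thus `gammaC ≤ gammaN` at every positive block length.

Achievability: a random code book covers the source at any rate above the information of the test
channel (`exists_code_of_channel`), and the relay merely forwards. Strict slack in the rate comes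
from mixing the channel with its output law (`exists_channel_natInfo_lt`); at rate zero no slack
exists, but then a constant reproduction suffices. The two bounds give the limit, and with it the
infimum. -/

lemma continuous_channel_apply {X A B : Type*} [TopologicalSpace X] [Fintype B]
    {f : X → Channel A B} (hf : Continuous f) (a : A) (b : B) :
    Continuous fun x => (f x a).1 b :=
  (continuous_apply b).comp (continuous_subtype_val.comp ((continuous_apply a).comp hf))

/-! ### Equal costs: the game as a team problem -/

section Attainment

variable {U V : Type*} [Fintype U] [Fintype V] {n : ℕ} {R₁ R₂ : ℝ}

lemma continuous_longRunCost (P : stdSimplex ℝ U) (c : U → V → ℝ) :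
    Continuous fun s : EncStrat U n R₁ × RelayStrat n R₁ R₂ × DecStrat V n R₂ =>
      longRunCost P c s.1 s.2.1 s.2.2 := by
  unfold longRunCost lawUV jointLaw
  refine continuous_finsetSum _ fun u _ => continuous_finsetSum _ fun v _ =>
    (continuous_finsetSum _ fun m₁ _ => continuous_finsetSum _ fun m₂ _ => ?_).mul
      continuous_const
  exact ((continuous_const.mul (continuous_channel_apply continuous_fst u m₁)).mul
    (continuous_channel_apply (continuous_fst.comp continuous_snd) m₁ m₂)).mul
    (continuous_channel_apply (continuous_snd.comp continuous_snd) m₂ v)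

lemma exists_min_longRunCost [Nonempty V] (P : stdSimplex ℝ U) (c : U → V → ℝ)
    (σ : EncStrat U n R₁) :
    ∃ p : RelayStrat n R₁ R₂ × DecStrat V n R₂, ∀ q : RelayStrat n R₁ R₂ × DecStrat V n R₂,
      longRunCost P c σ p.1 p.2 ≤ longRunCost P c σ q.1 q.2 := by
  have h : Continuous fun p : RelayStrat n R₁ R₂ × DecStrat V n R₂ =>
      longRunCost P c σ p.1 p.2 :=
    (continuous_longRunCost P c).comp
      (f := fun p : RelayStrat n R₁ R₂ × DecStrat V n R₂ => (σ, p)) (by fun_prop)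
  obtain ⟨p, -, hp⟩ := isCompact_univ.exists_isMinOn Set.univ_nonempty h.continuousOn
  exact ⟨p, fun q => hp (Set.mem_univ q)⟩

/-- A global minimizer over pairs is in particular optimal in `τ` for its own `μ`, so the decoder's
constraint costs the relay nothing. Every relay best response then attains the global minimum, and
ties do not matter to the encoder. -/
lemma encoderCosts_eq_singleton (P : stdSimplex ℝ U) (c : U → V → ℝ) (σ : EncStrat U n R₁)
    {p : RelayStrat n R₁ R₂ × DecStrat V n R₂}
    (hp : ∀ q : RelayStrat n R₁ R₂ × DecStrat V n R₂,
      longRunCost P c σ p.1 p.2 ≤ longRunCost P c σ q.1 q.2) :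
    encoderCosts R₂ P c c c σ = {longRunCost P c σ p.1 p.2} := by
  have hp' : p.2 ∈ decoderBR P c σ p.1 := fun τ' => hp (p.1, τ')
  refine Set.eq_singleton_iff_unique_mem.2 ⟨⟨p, ⟨hp', fun q _ => hp q⟩, rfl⟩, ?_⟩
  rintro _ ⟨q, ⟨_, hq⟩, rfl⟩
  exact le_antisymm (hq p hp') (hp q)

lemma isGreatest_worstCost [Nonempty V] (P : stdSimplex ℝ U) (c : U → V → ℝ)
    (σ : EncStrat U n R₁) :
    IsGreatest (encoderCosts R₂ P c c c σ) (worstCost R₂ P c c c σ) := by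
  obtain ⟨p, hp⟩ := exists_min_longRunCost (R₂ := R₂) P c σ
  rw [worstCost, encoderCosts_eq_singleton P c σ hp, csSup_singleton]
  exact isGreatest_singleton

lemma worstCost_le [Nonempty V] (P : stdSimplex ℝ U) (c : U → V → ℝ) (σ : EncStrat U n R₁)
    (μ : RelayStrat n R₁ R₂) (τ : DecStrat V n R₂) :
    worstCost R₂ P c c c σ ≤ longRunCost P c σ μ τ := by
  obtain ⟨p, hp⟩ := exists_min_longRunCost (R₂ := R₂) P c σ
  rw [worstCost, encoderCosts_eq_singleton P c σ hp, csSup_singleton]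
  exact hp (μ, τ)

lemma exists_worstCost_eq [Nonempty V] (P : stdSimplex ℝ U) (c : U → V → ℝ)
    (σ : EncStrat U n R₁) :
    ∃ (μ : RelayStrat n R₁ R₂) (τ : DecStrat V n R₂),
      worstCost R₂ P c c c σ = longRunCost P c σ μ τ := by
  obtain ⟨p, _, hp⟩ := (isGreatest_worstCost (R₂ := R₂) P c σ).1
  exact ⟨p.1, p.2, hp.symm⟩

lemma bddBelow_worstCost [Nonempty V] (P : stdSimplex ℝ U) (c : U → V → ℝ) :
    BddBelow (Set.range fun σ : EncStrat U n R₁ => worstCost R₂ P c c c σ) := by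
  obtain ⟨b, hb⟩ := (isCompact_range
    (continuous_longRunCost (n := n) (R₁ := R₁) (R₂ := R₂) P c)).bddBelow
  refine ⟨b, ?_⟩
  rintro _ ⟨σ, rfl⟩
  obtain ⟨μ, τ, h⟩ := exists_worstCost_eq (R₂ := R₂) P c σ
  exact (hb ⟨(σ, μ, τ), rfl⟩).trans_eq h.symm

lemma isGLB_gammaN [Nonempty V] (P : stdSimplex ℝ U) (c : U → V → ℝ) :
    IsGLB (Set.range fun σ : EncStrat U n R₁ => worstCost R₂ P c c c σ)
      (gammaN P c c c R₁ R₂ n) :=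
  isGLB_csInf (Set.range_nonempty _) (bddBelow_worstCost P c)

lemma gammaN_le [Nonempty V] (P : stdSimplex ℝ U) (c : U → V → ℝ) (σ : EncStrat U n R₁)
    (μ : RelayStrat n R₁ R₂) (τ : DecStrat V n R₂) :
    gammaN P c c c R₁ R₂ n ≤ longRunCost P c σ μ τ :=
  ((isGLB_gammaN P c).1 ⟨σ, rfl⟩).trans (worstCost_le P c σ μ τ)

lemma le_gammaN [Nonempty V] (P : stdSimplex ℝ U) (c : U → V → ℝ) {b : ℝ}
    (h : ∀ (σ : EncStrat U n R₁) (μ : RelayStrat n R₁ R₂) (τ : DecStrat V n R₂),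
      b ≤ longRunCost P c σ μ τ) :
    b ≤ gammaN P c c c R₁ R₂ n := by
  refine (isGLB_gammaN P c).2 ?_
  rintro _ ⟨σ, rfl⟩
  obtain ⟨μ, τ, h'⟩ := exists_worstCost_eq (R₂ := R₂) P c σ
  exact (h σ μ τ).trans_eq h'.symm

end Attainment

/-! ### The single-letter problem and mutual information -/

section SingleLetterAttainment

variable {U V W : Type*} [Fintype U] [Fintype V] [Fintype W]

lemma continuous_expCost (P : stdSimplex ℝ U) (c : U → V → ℝ) :
    Continuous fun s : Channel U W × Channel W V => expCost P c s.1 s.2 := by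
  unfold expCost
  refine continuous_finsetSum _ fun u _ => continuous_finsetSum _ fun w _ =>
    continuous_finsetSum _ fun v _ => Continuous.mul (Continuous.mul ?_ ?_) continuous_const
  · exact continuous_const.mul (continuous_channel_apply continuous_fst u w)
  · exact continuous_channel_apply continuous_snd w v

lemma exists_min_expCost [Nonempty V] (P : stdSimplex ℝ U) (c : U → V → ℝ) (Q : Channel U W) :
    ∃ T : Channel W V, ∀ T', expCost P c Q T ≤ expCost P c Q T' := by
  have h : Continuous fun T : Channel W V => expCost P c Q T :=
    (continuous_expCost P c).comp (f := fun T : Channel W V => (Q, T)) (by fun_prop)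
  obtain ⟨T, -, hT⟩ := isCompact_univ.exists_isMinOn Set.univ_nonempty h.continuousOn
  exact ⟨T, fun T' => hT (Set.mem_univ T')⟩

lemma singleCosts_eq_singleton (P : stdSimplex ℝ U) (c : U → V → ℝ) (Q : Channel U W)
    {T : Channel W V} (hT : ∀ T', expCost P c Q T ≤ expCost P c Q T') :
    singleCosts P c c Q = {expCost P c Q T} := by
  refine Set.eq_singleton_iff_unique_mem.2 ⟨⟨T, hT, rfl⟩, ?_⟩
  rintro _ ⟨T', hT', rfl⟩
  exact le_antisymm (hT' T) (hT T')

lemma isGreatest_singleWorst [Nonempty V] (P : stdSimplex ℝ U) (c : U → V → ℝ)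
    (Q : Channel U W) : IsGreatest (singleCosts P c c Q) (singleWorst P c c Q) := by
  obtain ⟨T, hT⟩ := exists_min_expCost P c Q
  rw [singleWorst, singleCosts_eq_singleton P c Q hT, csSup_singleton]
  exact isGreatest_singleton

lemma singleWorst_le [Nonempty V] (P : stdSimplex ℝ U) (c : U → V → ℝ) (Q : Channel U W)
    (T : Channel W V) : singleWorst P c c Q ≤ expCost P c Q T := by
  obtain ⟨T₀, hT₀⟩ := exists_min_expCost P c Q
  rw [singleWorst, singleCosts_eq_singleton P c Q hT₀, csSup_singleton]
  exact hT₀ T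

lemma exists_singleWorst_eq [Nonempty V] (P : stdSimplex ℝ U) (c : U → V → ℝ)
    (Q : Channel U W) : ∃ T : Channel W V, singleWorst P c c Q = expCost P c Q T := by
  obtain ⟨T, _, hT⟩ := (isGreatest_singleWorst P c Q).1
  exact ⟨T, hT.symm⟩

/-- The marginal distribution of the output of a channel. -/
def outputLaw (P : stdSimplex ℝ U) (Q : Channel U W) (w : W) : ℝ := ∑ u, P.1 u * (Q u).1 w

/-- Mutual information in nats. -/
def natInfo (P : stdSimplex ℝ U) (Q : Channel U W) : ℝ :=
  ∑ u, ∑ w, P.1 u * (Q u).1 w * Real.log ((Q u).1 w / outputLaw P Q w)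

lemma mutualInfo_eq (P : stdSimplex ℝ U) (Q : Channel U W) :
    mutualInfo P Q = natInfo P Q / Real.log 2 := by
  simp only [mutualInfo, natInfo, outputLaw, Real.logb, Finset.sum_div, mul_div_assoc]

lemma natInfo_const (P : stdSimplex ℝ U) (q : stdSimplex ℝ W) :
    natInfo P (fun _ => q) = 0 := by
  refine Finset.sum_eq_zero fun u _ => Finset.sum_eq_zero fun w _ => ?_
  have : outputLaw P (fun _ => q) w = q.1 w := by
    rw [outputLaw, ← Finset.sum_mul, P.2.2, one_mul]
  rw [this]
  rcases eq_or_ne (q.1 w) 0 with h | h <;> simp [h]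

lemma targets_nonempty [Nonempty W] (P : stdSimplex ℝ U) {R₁ R₂ : ℝ} (hR₁ : 0 ≤ R₁)
    (hR₂ : 0 ≤ R₂) : (targets W P R₁ R₂).Nonempty := by
  obtain ⟨q⟩ : Nonempty (stdSimplex ℝ W) := inferInstance
  refine ⟨fun _ => q, ?_⟩
  simp [targets, mutualInfo_eq, natInfo_const, hR₁, hR₂]

lemma isGLB_gammaC [Nonempty V] [Nonempty W] (P : stdSimplex ℝ U) (c : U → V → ℝ) {R₁ R₂ : ℝ}
    (hR₁ : 0 ≤ R₁) (hR₂ : 0 ≤ R₂) :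
    IsGLB ((fun Q => singleWorst P c c Q) '' targets W P R₁ R₂) (gammaC W P c c R₁ R₂) := by
  refine isGLB_csInf ((targets_nonempty P hR₁ hR₂).image _) ?_
  obtain ⟨b, hb⟩ := (isCompact_range (continuous_expCost (W := W) P c)).bddBelow
  refine ⟨b, ?_⟩
  rintro _ ⟨Q, _, rfl⟩
  obtain ⟨T, h⟩ := exists_singleWorst_eq P c Q
  exact (hb ⟨(Q, T), rfl⟩).trans_eq h.symm

lemma gammaC_le [Nonempty V] [Nonempty W] (P : stdSimplex ℝ U) (c : U → V → ℝ) {R₁ R₂ : ℝ}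
    (hR₁ : 0 ≤ R₁) (hR₂ : 0 ≤ R₂) {Q : Channel U W}
    (hQ : natInfo P Q ≤ min R₁ R₂ * Real.log 2) (T : Channel W V) :
    gammaC W P c c R₁ R₂ ≤ expCost P c Q T := by
  refine ((isGLB_gammaC P c hR₁ hR₂).1 ⟨Q, ?_, rfl⟩).trans (singleWorst_le P c Q T)
  rw [targets, Set.mem_ofPred_eq, mutualInfo_eq, ge_iff_le, div_le_iff₀ (Real.log_pos one_lt_two)]
  exact hQ

end SingleLetterAttainment

/-! ### Point-to-point converse -/

section Converse

variable {U V M : Type*} [Fintype U] [Fintype V] [Fintype M] {n : ℕ}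

lemma outputLaw_nonneg (P : stdSimplex ℝ U) (Q : Channel U V) (v : V) : 0 ≤ outputLaw P Q v :=
  Finset.sum_nonneg fun u _ => mul_nonneg (P.2.1 u) ((Q u).2.1 v)

lemma outputLaw_pos (P : stdSimplex ℝ U) (Q : Channel U V) {u : U} {v : V}
    (h : 0 < P.1 u * (Q u).1 v) : 0 < outputLaw P Q v :=
  h.trans_le (Finset.single_le_sum (f := fun u => P.1 u * (Q u).1 v)
    (fun u _ => mul_nonneg (P.2.1 u) ((Q u).2.1 v)) (Finset.mem_univ u))

/-- The composition of two channels. -/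
def Channel.comp {A B C : Type*} [Fintype B] [Fintype C] (σ : Channel A B) (μ : Channel B C) :
    Channel A C := fun a =>
  ⟨fun c => ∑ b, (σ a).1 b * (μ b).1 c,
    fun c => Finset.sum_nonneg fun b _ => mul_nonneg ((σ a).2.1 b) ((μ b).2.1 c), by
      rw [Finset.sum_comm]
      simp_rw [← Finset.mul_sum, (μ _).2.2, mul_one]
      exact (σ a).2.2⟩

/-- The joint law of source and reproduction for a point-to-point code. -/
def codeLaw (P : stdSimplex ℝ U) (σ : Channel (Fin n → U) M) (τ : Channel M (Fin n → V))
    (u : Fin n → U) (v : Fin n → V) : ℝ :=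
  (∏ t, P.1 (u t)) * ∑ m, (σ u).1 m * (τ m).1 v

lemma codeLaw_nonneg (P : stdSimplex ℝ U) (σ : Channel (Fin n → U) M)
    (τ : Channel M (Fin n → V)) (u : Fin n → U) (v : Fin n → V) : 0 ≤ codeLaw P σ τ u v :=
  mul_nonneg (Finset.prod_nonneg fun t _ => P.2.1 (u t))
    (Finset.sum_nonneg fun m _ => mul_nonneg ((σ u).2.1 m) ((τ m).2.1 v))

lemma sum_codeLaw (P : stdSimplex ℝ U) (σ : Channel (Fin n → U) M)
    (τ : Channel M (Fin n → V)) (u : Fin n → U) :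
    ∑ v, codeLaw P σ τ u v = ∏ t, P.1 (u t) := by
  simp_rw [codeLaw]
  rw [← Finset.mul_sum]
  exact (congrArg _ (Channel.comp σ τ u).2.2).trans (mul_one _)

lemma sum_prod_law (p : U → ℝ) (hp : ∑ a, p a = 1) (n : ℕ) :
    ∑ u : Fin n → U, ∏ t, p (u t) = 1 := by
  rw [← Fintype.prod_sum fun (_ : Fin n) a => p a]
  simp [hp]

lemma sum_prod_law_mul (p : U → ℝ) (hp : ∑ a, p a = 1) (f : U → ℝ) (t : Fin n) :
    ∑ u : Fin n → U, (∏ s, p (u s)) * f (u t) = ∑ a, p a * f a := by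
  classical
  have h : ∀ u : Fin n → U, (∏ s, p (u s)) * f (u t) =
      ∏ s, (p (u s) * if s = t then f (u s) else 1) := fun u => by
    rw [Finset.prod_mul_distrib, Finset.prod_ite_eq' Finset.univ t fun s => f (u s)]
    simp
  simp_rw [h]
  rw [← Fintype.prod_sum fun s a => p a * if s = t then f a else 1,
    Finset.prod_eq_single t]
  · simp
  · intro s _ hs
    simp [hs, hp]
  · simp

/-- The expected number of positions at which source and reproduction take the values `a`, `b`. -/
def expCount [DecidableEq U] [DecidableEq V] (P : stdSimplex ℝ U) (σ : Channel (Fin n → U) M)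
    (τ : Channel M (Fin n → V)) (a : U) (b : V) : ℝ :=
  ∑ u, ∑ v, codeLaw P σ τ u v * ∑ t, if u t = a ∧ v t = b then 1 else 0

/-- Additive functionals see a code only through its expected letter-pair counts. This is applied to
indicators, to log-likelihood ratios and to the cost. -/
lemma sum_codeLaw_mul_sum [DecidableEq U] [DecidableEq V] (P : stdSimplex ℝ U)
    (σ : Channel (Fin n → U) M) (τ : Channel M (Fin n → V)) (f : U → V → ℝ) :
    ∑ u, ∑ v, codeLaw P σ τ u v * ∑ t, f (u t) (v t) =
      ∑ a, ∑ b, expCount P σ τ a b * f a b := by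
  have h : ∀ (u : Fin n → U) (v : Fin n → V),
      ∑ a, ∑ b, (∑ t, if u t = a ∧ v t = b then 1 else 0) * f a b = ∑ t, f (u t) (v t) :=
    fun u v => by
      simp_rw [Finset.sum_mul]
      refine (Finset.sum_congr rfl fun a _ => Finset.sum_comm).trans (Finset.sum_comm.trans ?_)
      refine Finset.sum_congr rfl fun t _ => ?_
      simp [ite_and]
  simp_rw [← h, expCount, Finset.sum_mul, Finset.mul_sum, Finset.sum_mul, mul_assoc]
  calc _ = ∑ u : Fin n → U, ∑ a, ∑ v : Fin n → V, ∑ b, _ :=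
        Finset.sum_congr rfl fun u _ => Finset.sum_comm
    _ = ∑ u : Fin n → U, ∑ a, ∑ b, ∑ v : Fin n → V, _ :=
        Finset.sum_congr rfl fun u _ => Finset.sum_congr rfl fun a _ => Finset.sum_comm
    _ = ∑ a, ∑ u : Fin n → U, ∑ b, ∑ v : Fin n → V, _ := Finset.sum_comm
    _ = _ := Finset.sum_congr rfl fun a _ => Finset.sum_comm

lemma expCount_nonneg [DecidableEq U] [DecidableEq V] (P : stdSimplex ℝ U)
    (σ : Channel (Fin n → U) M) (τ : Channel M (Fin n → V)) (a : U) (b : V) :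
    0 ≤ expCount P σ τ a b :=
  Finset.sum_nonneg fun u _ => Finset.sum_nonneg fun v _ =>
    mul_nonneg (codeLaw_nonneg P σ τ u v) (Finset.sum_nonneg fun t _ => by split_ifs <;> simp)

lemma sum_expCount [DecidableEq U] [DecidableEq V] (P : stdSimplex ℝ U)
    (σ : Channel (Fin n → U) M) (τ : Channel M (Fin n → V)) (a : U) :
    ∑ b, expCount P σ τ a b = n * P.1 a := by
  have h := sum_codeLaw_mul_sum P σ τ fun a' _ => if a' = a then 1 else 0
  simp_rw [← Finset.sum_mul, sum_codeLaw, Finset.mul_sum] at h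
  rw [Finset.sum_comm] at h
  simp_rw [sum_prod_law_mul P.1 P.2.2 fun a' => if a' = a then (1 : ℝ) else 0] at h
  simpa using h.symm

/-- A word pair is counted at least once at each of its own letter pairs. Hence word pairs of
positive probability have only letter pairs of positive averaged probability, so their likelihood
ratios are positive. -/
lemma codeLaw_le_expCount [DecidableEq U] [DecidableEq V] (P : stdSimplex ℝ U)
    (σ : Channel (Fin n → U) M) (τ : Channel M (Fin n → V)) (u : Fin n → U) (v : Fin n → V)
    (t : Fin n) : codeLaw P σ τ u v ≤ expCount P σ τ (u t) (v t) := by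
  have hc : ∀ (u' : Fin n → U) (v' : Fin n → V),
      0 ≤ ∑ s, if u' s = u t ∧ v' s = v t then (1 : ℝ) else 0 := fun u' v' =>
    Finset.sum_nonneg fun s _ => by split_ifs <;> simp
  have h1 : (1 : ℝ) ≤ ∑ s, if u s = u t ∧ v s = v t then (1 : ℝ) else 0 := by
    refine le_trans ?_ (Finset.single_le_sum (f := fun s => if u s = u t ∧ v s = v t then
      (1 : ℝ) else 0) (fun s _ => by split_ifs <;> simp) (Finset.mem_univ t))
    simp
  have hn : ∀ u' v', 0 ≤ codeLaw P σ τ u' v' *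
      ∑ s, if u' s = u t ∧ v' s = v t then (1 : ℝ) else 0 := fun u' v' =>
    mul_nonneg (codeLaw_nonneg P σ τ u' v') (hc u' v')
  calc codeLaw P σ τ u v ≤ codeLaw P σ τ u v *
        ∑ s, if u s = u t ∧ v s = v t then (1 : ℝ) else 0 :=
        le_mul_of_one_le_right (codeLaw_nonneg P σ τ u v) h1
    _ ≤ ∑ v', codeLaw P σ τ u v' * ∑ s, if u s = u t ∧ v' s = v t then (1 : ℝ) else 0 :=
        Finset.single_le_sum (f := fun v' => codeLaw P σ τ u v' *
          ∑ s, if u s = u t ∧ v' s = v t then (1 : ℝ) else 0) (fun v' _ => hn u v')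
          (Finset.mem_univ v)
    _ ≤ _ := Finset.single_le_sum (f := fun u' => ∑ v', codeLaw P σ τ u' v' *
          ∑ s, if u' s = u t ∧ v' s = v t then (1 : ℝ) else 0)
          (fun u' _ => Finset.sum_nonneg fun v' _ => hn u' v') (Finset.mem_univ u)

/-- The product of likelihood ratios has expectation at most one for independent source and
reproduction. -/
lemma sum_prod_likelihoodRatio_le (P : stdSimplex ℝ U) (Q : Channel U V) (v : Fin n → V) :
    ∑ u : Fin n → U, (∏ t, P.1 (u t)) *
      ∏ t, ((Q (u t)).1 (v t) / outputLaw P Q (v t)) ≤ 1 := by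
  simp_rw [← Finset.prod_mul_distrib]
  rw [← Fintype.prod_sum fun t a => P.1 a * ((Q a).1 (v t) / outputLaw P Q (v t))]
  refine Finset.prod_le_one (fun t _ => Finset.sum_nonneg fun a _ => mul_nonneg (P.2.1 a)
    (div_nonneg ((Q a).2.1 _) (outputLaw_nonneg P Q _))) fun t _ => ?_
  simp_rw [← mul_div_assoc, ← Finset.sum_div]
  exact div_self_le_one _

/-- Bounding `σ(m|u)` by one dominates the code law by a sum over messages of laws under which
source and reproduction are independent. Each message contributes at most one. -/
lemma sum_codeLaw_mul_likelihoodRatio_le (P : stdSimplex ℝ U) (σ : Channel (Fin n → U) M)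
    (τ : Channel M (Fin n → V)) (Q : Channel U V) :
    ∑ u, ∑ v, codeLaw P σ τ u v * ∏ t, ((Q (u t)).1 (v t) / outputLaw P Q (v t)) ≤
      Fintype.card M := by
  set h : (Fin n → U) → (Fin n → V) → ℝ := fun u v =>
    ∏ t, ((Q (u t)).1 (v t) / outputLaw P Q (v t)) with hh
  have hnn : ∀ u v, 0 ≤ h u v := fun u v => Finset.prod_nonneg fun t _ =>
    div_nonneg ((Q _).2.1 _) (outputLaw_nonneg P Q _)
  calc ∑ u, ∑ v, codeLaw P σ τ u v * h u v
      ≤ ∑ u, ∑ v, ∑ m, (τ m).1 v * ((∏ t, P.1 (u t)) * h u v) := by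
        refine Finset.sum_le_sum fun u _ => Finset.sum_le_sum fun v _ => ?_
        rw [codeLaw, ← Finset.sum_mul, mul_right_comm, mul_comm]
        refine mul_le_mul_of_nonneg_right (Finset.sum_le_sum fun m _ => ?_)
          (mul_nonneg (Finset.prod_nonneg fun t _ => P.2.1 _) (hnn u v))
        refine mul_le_of_le_one_left ((τ m).2.1 v) ?_
        rw [← (σ u).2.2]
        exact Finset.single_le_sum (fun m _ => (σ u).2.1 m) (Finset.mem_univ m)
    _ = ∑ v, ∑ m, (τ m).1 v * ∑ u, (∏ t, P.1 (u t)) * h u v := by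
        rw [Finset.sum_comm]
        refine Finset.sum_congr rfl fun v _ => ?_
        rw [Finset.sum_comm]
        simp_rw [Finset.mul_sum]
    _ ≤ ∑ v, ∑ m, (τ m).1 v * 1 :=
        Finset.sum_le_sum fun v _ => Finset.sum_le_sum fun m _ =>
          mul_le_mul_of_nonneg_left (sum_prod_likelihoodRatio_le P Q v) ((τ m).2.1 v)
    _ = Fintype.card M := by
        rw [Finset.sum_comm]
        simp [(τ _).2.2]

/-- The channel is the conditional law of the letter pair at a uniformly chosen time. Then `n *
natInfo P Q` is the expected logarithm of the product likelihood ratio, whose expectation is at most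
the number of messages; concavity of the logarithm concludes. -/
lemma exists_singleLetter_channel [Nonempty V] (P : stdSimplex ℝ U) (hn : 0 < n)
    (σ : Channel (Fin n → U) M) (τ : Channel M (Fin n → V)) :
    ∃ Q : Channel U V, n * natInfo P Q ≤ Real.log (Fintype.card M) ∧
      ∀ c : U → V → ℝ, ∑ u, ∑ v, codeLaw P σ τ u v * (1 / (n : ℝ) * ∑ t, c (u t) (v t)) =
        ∑ a, ∑ b, P.1 a * (Q a).1 b * c a b := by
  classical
  have hn' : (0 : ℝ) < n := by exact_mod_cast hn
  obtain ⟨q₀⟩ : Nonempty (stdSimplex ℝ V) := inferInstance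
  -- Source letters of probability zero have vanishing counts, so the law `q₀` chosen there is
  -- immaterial.
  let Q : Channel U V := fun a => if h : P.1 a = 0 then q₀ else
    ⟨fun b => expCount P σ τ a b / (n * P.1 a),
      fun b => div_nonneg (expCount_nonneg P σ τ a b) (mul_nonneg hn'.le (P.2.1 a)), by
        rw [← Finset.sum_div, sum_expCount, div_self (mul_ne_zero hn'.ne' h)]⟩
  have hQ : ∀ a b, expCount P σ τ a b = n * (P.1 a * (Q a).1 b) := fun a b => by
    by_cases h : P.1 a = 0
    · have h0 := sum_expCount P σ τ a
      rw [h, mul_zero, Finset.sum_eq_zero_iff_of_nonneg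
        fun b _ => expCount_nonneg P σ τ a b] at h0
      rw [h0 b (Finset.mem_univ b), h, zero_mul, mul_zero]
    · simp only [Q, h, dite_false]
      field_simp
  have hM : (0 : ℝ) < Fintype.card M := by
    obtain ⟨a⟩ : Nonempty U := by
      by_contra h
      rw [not_nonempty_iff] at h
      simpa using P.2.2
    have : Nonempty M := by
      by_contra h
      rw [not_nonempty_iff] at h
      simpa using (σ fun _ => a).2.2
    exact_mod_cast Fintype.card_pos
  refine ⟨Q, ?_, fun c => ?_⟩
  · set r : U → V → ℝ := fun a b => (Q a).1 b / outputLaw P Q b with hr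
    have h1 : n * natInfo P Q = ∑ u, ∑ v, codeLaw P σ τ u v * ∑ t, Real.log (r (u t) (v t)) := by
      rw [sum_codeLaw_mul_sum P σ τ fun a b => Real.log (r a b)]
      simp_rw [natInfo, Finset.mul_sum, hQ, mul_assoc]
      rfl
    -- Jensen's inequality through the tangent to the logarithm at `card M`; the weight `codeLaw`
    -- removes the pairs where a ratio might vanish.
    have hpoint : ∀ u v, codeLaw P σ τ u v * ∑ t, Real.log (r (u t) (v t)) ≤
        codeLaw P σ τ u v * (Real.log (Fintype.card M) - 1) +
          codeLaw P σ τ u v * (∏ t, r (u t) (v t)) / Fintype.card M := fun u v => by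
      rcases (codeLaw_nonneg P σ τ u v).eq_or_lt with h | h
      · simp [← h]
      · have hpos : ∀ t, 0 < r (u t) (v t) := fun t => by
          have h2 := h.trans_le (codeLaw_le_expCount P σ τ u v t)
          rw [hQ] at h2
          have h3 := pos_of_mul_pos_right h2 hn'.le
          exact div_pos (pos_of_mul_pos_right h3 (P.2.1 _)) (outputLaw_pos P Q h3)
        rw [mul_div_assoc, ← mul_add]
        refine mul_le_mul_of_nonneg_left ?_ h.le
        rw [← Real.log_prod fun t _ => (hpos t).ne']
        have hp : 0 < ∏ t, r (u t) (v t) := Finset.prod_pos fun t _ => hpos t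
        have := Real.log_le_sub_one_of_pos (div_pos hp hM)
        rw [Real.log_div hp.ne' hM.ne'] at this
        linarith
    have hsum : ∑ u, ∑ v, codeLaw P σ τ u v = 1 := by
      simp_rw [sum_codeLaw]
      exact sum_prod_law P.1 P.2.2 n
    have hratio := sum_codeLaw_mul_likelihoodRatio_le P σ τ Q
    rw [h1]
    refine (Finset.sum_le_sum fun u _ => Finset.sum_le_sum fun v _ => hpoint u v).trans ?_
    simp_rw [Finset.sum_add_distrib, ← Finset.sum_mul, ← Finset.sum_div, hsum]
    have := (div_le_one hM).2 hratio
    linarith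
  · have h := sum_codeLaw_mul_sum P σ τ c
    simp_rw [mul_left_comm _ (1 / (n : ℝ)), ← Finset.mul_sum, h, hQ, Finset.mul_sum]
    refine Finset.sum_congr rfl fun a _ => Finset.sum_congr rfl fun b _ => ?_
    field_simp

end Converse

/-! ### Sparse solutions of linear programs -/

section SmallSupport

variable {ι V : Type*} [Fintype ι] [Fintype V]

lemma exists_relation_on_support (a : V → ι → ℝ) (s : V → ℝ)
    (hcard : Fintype.card ι < (Finset.univ.filter fun v => s v ≠ 0).card) :
    ∃ δ : V → ℝ, (∀ v, s v = 0 → δ v = 0) ∧ (∀ i, ∑ v, δ v * a v i = 0) ∧ ∃ v, δ v ≠ 0 := by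
  classical
  set S := Finset.univ.filter fun v => s v ≠ 0 with hS
  have hdep : ¬ LinearIndependent ℝ fun v : S => a v := fun h => by
    have := h.fintype_card_le_finrank
    rw [Module.finrank_fintype_fun_eq_card, Fintype.card_coe] at this
    omega
  obtain ⟨g, hg, ⟨v₀, hv₀⟩, hne⟩ := Fintype.not_linearIndependent_iff.1 hdep
  refine ⟨fun v => if h : v ∈ S then g ⟨v, h⟩ else 0, fun v hv => ?_, fun i => ?_, v₀, ?_⟩
  · simp [hS, hv]
  · have hi := congrFun hg i
    rw [Finset.sum_apply] at hi
    rw [Pi.zero_apply] at hi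
    refine Eq.trans (Eq.symm ?_) hi
    refine Fintype.sum_of_injective (fun v : S => (v : V)) Subtype.val_injective _ _ ?_ ?_
    · intro v hv
      have : v ∉ S := fun h => hv ⟨⟨v, h⟩, rfl⟩
      simp [this]
    · rintro ⟨v, hv⟩
      simp [hv]
  · simpa [hv₀] using hne

/-- Move from `s` along a linear relation `δ` among the constraint vectors, oriented so that the
objective does not increase, until a coordinate vanishes. The combination `l`, positive on the
support, prevents `δ` from being nonnegative, so the orthant is eventually left. -/
lemma exists_smaller_support (a : V → ι → ℝ) (d : V → ℝ) (l : ι → ℝ) (s : V → ℝ)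
    (hs : ∀ v, 0 ≤ s v) (hl : ∀ v, s v ≠ 0 → 0 < ∑ i, l i * a v i)
    (hcard : Fintype.card ι < (Finset.univ.filter fun v => s v ≠ 0).card) :
    ∃ s' : V → ℝ, (∀ v, 0 ≤ s' v) ∧ (∀ v, s v = 0 → s' v = 0) ∧
      (∃ v, s v ≠ 0 ∧ s' v = 0) ∧
      (∀ i, ∑ v, s' v * a v i = ∑ v, s v * a v i) ∧ ∑ v, s' v * d v ≤ ∑ v, s v * d v := by
  classical
  obtain ⟨δ, hδs, hδa, hδne, hδd⟩ : ∃ δ : V → ℝ, (∀ v, s v = 0 → δ v = 0) ∧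
      (∀ i, ∑ v, δ v * a v i = 0) ∧ (∃ v, δ v ≠ 0) ∧ ∑ v, δ v * d v ≤ 0 := by
    obtain ⟨δ, h1, h2, v, h3⟩ := exists_relation_on_support a s hcard
    rcases le_total (∑ v, δ v * d v) 0 with h | h
    · exact ⟨δ, h1, h2, ⟨v, h3⟩, h⟩
    · refine ⟨fun v => -δ v, fun v hv => by simp [h1 v hv], fun i => ?_, ⟨v, by simpa using h3⟩, ?_⟩
      · simp [h2 i]
      · simpa using h
  obtain ⟨v₁, hv₁⟩ : ∃ v, δ v < 0 := by
    by_contra! hcon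
    have h0 : ∑ v, δ v * ∑ i, l i * a v i = 0 := by
      simp_rw [Finset.mul_sum, mul_left_comm _ (l _)]
      rw [Finset.sum_comm]
      simp_rw [← Finset.mul_sum, hδa, mul_zero, Finset.sum_const_zero]
    have hnn : ∀ v ∈ Finset.univ, 0 ≤ δ v * ∑ i, l i * a v i := fun v _ => by
      by_cases hv : s v = 0
      · simp [hδs v hv]
      · exact mul_nonneg (hcon v) (hl v hv).le
    obtain ⟨v, hv⟩ := hδne
    have := (Finset.sum_eq_zero_iff_of_nonneg hnn).1 h0 v (Finset.mem_univ v)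
    exact (mul_ne_zero hv (hl v fun h => hv (hδs v h)).ne') this
  -- Ratio test: `T` is the longest step keeping all coordinates nonnegative, and `v₂` is a
  -- coordinate that it kills.
  obtain ⟨v₂, hv₂, hmin⟩ := (Finset.univ.filter fun v => δ v < 0).exists_min_image
    (fun v => s v / (-δ v)) ⟨v₁, by simpa using hv₁⟩
  simp only [Finset.mem_filter, Finset.mem_univ, true_and] at hv₂ hmin
  set T := s v₂ / (-δ v₂) with hT
  have hT0 : 0 ≤ T := div_nonneg (hs v₂) (by linarith)
  refine ⟨fun v => s v + T * δ v, fun v => ?_, fun v hv => by simp [hv, hδs v hv],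
    ⟨v₂, fun h => hv₂.ne (hδs v₂ h), ?_⟩, fun i => ?_, ?_⟩
  · by_cases hv : δ v < 0
    · have := (le_div_iff₀ (by linarith : 0 < -δ v)).1 (hmin v hv)
      linarith
    · exact add_nonneg (hs v) (mul_nonneg hT0 (not_lt.1 hv))
  · change s v₂ + T * δ v₂ = 0
    rw [hT, div_neg, neg_mul, div_mul_cancel₀ _ hv₂.ne, add_neg_cancel]
  · simp_rw [add_mul, Finset.sum_add_distrib, mul_assoc, ← Finset.mul_sum, hδa, mul_zero, add_zero]
  · simp_rw [add_mul, Finset.sum_add_distrib, mul_assoc, ← Finset.mul_sum]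
    have := mul_nonneg hT0 (neg_nonneg.2 hδd)
    linarith

/-- A linear program with constraints indexed by `ι` has a solution, at least as good as a given
feasible point, supported on at most `card ι` points. -/
lemma exists_support_card_le (a : V → ι → ℝ) (d : V → ℝ) (l : ι → ℝ) (s : V → ℝ)
    (hs : ∀ v, 0 ≤ s v) (hl : ∀ v, s v ≠ 0 → 0 < ∑ i, l i * a v i) :
    ∃ s' : V → ℝ, (∀ v, 0 ≤ s' v) ∧
      (Finset.univ.filter fun v => s' v ≠ 0).card ≤ Fintype.card ι ∧
      (∀ i, ∑ v, s' v * a v i = ∑ v, s v * a v i) ∧ ∑ v, s' v * d v ≤ ∑ v, s v * d v := by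
  induction hk : (Finset.univ.filter fun v => s v ≠ 0).card using Nat.strong_induction_on
    generalizing s with
  | _ k ih =>
    rcases le_or_gt (Finset.univ.filter fun v => s v ≠ 0).card (Fintype.card ι) with h | h
    · exact ⟨s, hs, h, fun _ => rfl, le_rfl⟩
    · obtain ⟨s₁, h1, h2, ⟨v, hv, hv'⟩, h3, h4⟩ := exists_smaller_support a d l s hs hl h
      have hlt : (Finset.univ.filter fun v => s₁ v ≠ 0).card < k := by
        rw [← hk]
        refine Finset.card_lt_card (Finset.ssubset_iff_subset_ne.2 ⟨fun w hw => ?_, fun he => ?_⟩)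
        · simp only [Finset.mem_filter, Finset.mem_univ, true_and] at hw ⊢
          exact fun h => hw (h2 w h)
        · have : v ∈ Finset.univ.filter fun v => s v ≠ 0 := by simpa using hv
          rw [← he] at this
          simp [hv'] at this
      obtain ⟨s', g1, g2, g3, g4⟩ := ih _ hlt s₁ h1 (fun w hw => hl w fun h => hw (h2 w h)) rfl
      exact ⟨s', g1, g2, fun i => (g3 i).trans (h3 i), g4.trans h4⟩

end SmallSupport

/-! ### Reducing the auxiliary alphabet -/

section Alphabet

variable {U V W : Type*} [Fintype U] [Fintype V] [Fintype W]

/-- The expected cost when the channel output is itself the reproduction. -/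
def directCost (P : stdSimplex ℝ U) (c : U → V → ℝ) (Q : Channel U V) : ℝ :=
  ∑ u, ∑ v, P.1 u * (Q u).1 v * c u v

/-- Multiplying each output column by a weight `s' v` leaves the likelihood ratios unchanged
wherever the weight is nonzero. Information, cost and row normalizations are therefore linear in the
weights. Fixing the information and the `|U|` row sums gives `|U| + 1` constraints, with the cost as
objective. -/
lemma exists_channel_small_support (P : stdSimplex ℝ U) (c : U → V → ℝ) (Q : Channel U V) :
    ∃ (Q' : Channel U V) (S : Finset V), S.card ≤ Fintype.card U + 1 ∧
      (∀ u, ∀ v ∉ S, (Q' u).1 v = 0) ∧ natInfo P Q' = natInfo P Q ∧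
      directCost P c Q' ≤ directCost P c Q := by
  classical
  let a : V → Option U → ℝ := fun v i => i.elim
    (∑ u, P.1 u * (Q u).1 v * Real.log ((Q u).1 v / outputLaw P Q v)) fun u => (Q u).1 v
  -- Outputs that never occur start with weight zero: positivity of the summed row constraints fails
  -- for them.
  let s : V → ℝ := fun v => if ∀ u, (Q u).1 v = 0 then 0 else 1
  have hsQ : ∀ u v, s v * (Q u).1 v = (Q u).1 v := fun u v => by
    simp only [s]
    split_ifs with h
    · simp [h u]
    · simp
  obtain ⟨s', h1, h2, h3, h4⟩ := exists_support_card_le a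
    (fun v => ∑ u, P.1 u * (Q u).1 v * c u v) (fun i => i.elim 0 fun _ => 1) s
    (fun v => by simp only [s]; split_ifs <;> simp) (fun v hv => by
      simp only [s, ne_eq, ite_eq_left_iff, one_ne_zero, imp_false, not_not] at hv
      rw [not_forall] at hv
      obtain ⟨u, hu⟩ := hv
      simp only [Fintype.sum_option, a, Option.elim, zero_mul, one_mul, zero_add]
      exact Finset.sum_pos' (fun u _ => (Q u).2.1 v)
        ⟨u, Finset.mem_univ u, lt_of_le_of_ne ((Q u).2.1 v) (Ne.symm hu)⟩)
  rw [Fintype.card_option] at h2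
  let Q' : Channel U V := fun u => ⟨fun v => s' v * (Q u).1 v,
    fun v => mul_nonneg (h1 v) ((Q u).2.1 v), by
      have := h3 (some u)
      simp only [a, Option.elim, hsQ] at this
      exact this.trans (Q u).2.2⟩
  have hQ' : ∀ u v, (Q' u).1 v = s' v * (Q u).1 v := fun _ _ => rfl
  refine ⟨Q', Finset.univ.filter fun v => s' v ≠ 0, h2, fun u v hv => ?_, ?_, ?_⟩
  · have : s' v = 0 := by simpa using hv
    rw [hQ', this, zero_mul]
  · have hout : ∀ v, outputLaw P Q' v = s' v * outputLaw P Q v := fun v => by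
      simp_rw [outputLaw, hQ', Finset.mul_sum, mul_left_comm]
    have h := h3 none
    simp only [a, Option.elim, Finset.mul_sum] at h
    rw [natInfo, natInfo, Finset.sum_comm]
    conv_rhs => rw [Finset.sum_comm]
    refine Eq.trans ?_ (h.trans ?_)
    · refine Finset.sum_congr rfl fun v _ => Finset.sum_congr rfl fun u _ => ?_
      rw [hout, hQ']
      by_cases hv : s' v = 0
      · simp [hv]
      · rw [mul_div_mul_left _ _ hv]
        ring
    · refine Finset.sum_congr rfl fun v _ => Finset.sum_congr rfl fun u _ => ?_
      rw [← mul_assoc, mul_left_comm, hsQ]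
  · simp only [Finset.mul_sum] at h4
    rw [directCost, directCost, Finset.sum_comm]
    conv_rhs => rw [Finset.sum_comm]
    refine Eq.trans_le ?_ (h4.trans_eq ?_)
    · refine Finset.sum_congr rfl fun v _ => Finset.sum_congr rfl fun u _ => ?_
      rw [hQ']
      ring
    · refine Finset.sum_congr rfl fun v _ => Finset.sum_congr rfl fun u _ => ?_
      rw [← mul_assoc, mul_left_comm, hsQ]

/-- The point mass at `b`. -/
def pointMass {B : Type*} [Fintype B] [DecidableEq B] (b : B) : stdSimplex ℝ B :=
  ⟨Pi.single b 1, single_mem_stdSimplex ℝ b⟩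

lemma pointMass_apply {B : Type*} [Fintype B] [DecidableEq B] (b b' : B) :
    (pointMass b).1 b' = if b' = b then 1 else 0 := by
  simp [pointMass, Pi.single_apply]

/-- A channel with few outputs can be realised over another auxiliary alphabet. -/
lemma exists_relabelled_channel [Nonempty V] (P : stdSimplex ℝ U) (c : U → V → ℝ)
    (Q : Channel U V) (S : Finset V) (hS : ∀ u, ∀ v ∉ S, (Q u).1 v = 0)
    (hcard : S.card ≤ Fintype.card W) :
    ∃ (Q' : Channel U W) (T : Channel W V), natInfo P Q' = natInfo P Q ∧
      expCost P c Q' T = directCost P c Q := by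
  classical
  rw [← Fintype.card_coe] at hcard
  obtain ⟨j⟩ := Function.Embedding.nonempty_of_card_le hcard
  have v₀ : V := Classical.arbitrary V
  let q : U → W → ℝ := fun u w => if h : ∃ v : S, j v = w then (Q u).1 h.choose else 0
  have hqj : ∀ u v, q u (j v) = (Q u).1 v := fun u v => by
    have h : ∃ v' : S, j v' = j v := ⟨v, rfl⟩
    simp only [q, h, dite_true]
    rw [j.injective h.choose_spec]
  have hq0 : ∀ u, ∀ w ∉ Set.range j, q u w = 0 := fun u w hw => by
    have h : ¬ ∃ v : S, j v = w := hw
    simp only [q, h, dite_false]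
  -- Sums over `W` and over `V` both reduce to the common support `S`.
  have hsum : ∀ (F : V → ℝ) (G : W → ℝ), (∀ v : S, G (j v) = F v) →
      (∀ w ∉ Set.range j, G w = 0) → (∀ v ∉ S, F v = 0) → ∑ w, G w = ∑ v, F v := by
    intro F G h1 h2 h3
    rw [← Fintype.sum_of_injective j j.injective (fun v => F v) G h2 fun v => (h1 v).symm]
    refine Fintype.sum_of_injective (fun v : S => (v : V)) Subtype.val_injective _ _ ?_ fun _ => rfl
    exact fun v hv => h3 v fun h => hv ⟨⟨v, h⟩, rfl⟩
  let Q' : Channel U W := fun u => ⟨q u, fun w => by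
      simp only [q]
      split_ifs with h
      · exact (Q u).2.1 _
      · exact le_rfl, (hsum (Q u).1 (q u) (hqj u) (hq0 u) (hS u)).trans (Q u).2.2⟩
  let T : Channel W V := fun w =>
    pointMass (if h : ∃ v : S, j v = w then (h.choose : V) else v₀)
  have hT : ∀ v, T (j v) = pointMass (v : V) := fun v => by
    have h : ∃ v' : S, j v' = j v := ⟨v, rfl⟩
    simp only [T, h, dite_true]
    rw [j.injective h.choose_spec]
  have hQj : ∀ u v, (Q' u).1 (j v) = (Q u).1 v := hqj
  have hQ0 : ∀ u, ∀ w ∉ Set.range j, (Q' u).1 w = 0 := hq0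
  refine ⟨Q', T, Finset.sum_congr rfl fun u _ => ?_, Finset.sum_congr rfl fun u _ => ?_⟩
  · refine hsum _ _ (fun v => ?_) (fun w hw => ?_) fun v hv => ?_
    · simp only [outputLaw, hQj]
    · simp [hQ0 u w hw]
    · simp [hS u v hv]
  · refine hsum _ _ (fun v => ?_) (fun w hw => ?_) fun v hv => ?_
    · simp [hQj, hT, pointMass_apply]
    · simp [hQ0 u w hw]
    · simp [hS u v hv]

end Alphabet

/-! ### Converse for the cascade -/

section ConverseBound

variable {U V W : Type*} [Fintype U] [Fintype V] [Fintype W]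

lemma gammaC_le_directCost (hW : min (Fintype.card U + 1) (Fintype.card V) ≤ Fintype.card W)
    [Nonempty V] [Nonempty W] (P : stdSimplex ℝ U) (c : U → V → ℝ) {R₁ R₂ : ℝ} (hR₁ : 0 ≤ R₁) (hR₂ : 0 ≤ R₂)
    (Q : Channel U V) (hQ : natInfo P Q ≤ min R₁ R₂ * Real.log 2) :
    gammaC W P c c R₁ R₂ ≤ directCost P c Q := by
  rcases min_le_iff.1 hW with h | h
  · obtain ⟨Q₁, S, hS, hQ₁S, hI, hc⟩ := exists_channel_small_support P c Q
    obtain ⟨Q', T, hI', hc'⟩ := exists_relabelled_channel P c Q₁ S hQ₁S (hS.trans h)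
    exact (gammaC_le P c hR₁ hR₂ ((hI'.trans hI).trans_le hQ) T).trans (hc'.trans_le hc)
  · obtain ⟨Q', T, hI', hc'⟩ := exists_relabelled_channel (W := W) P c Q Finset.univ
      (fun u v hv => absurd (Finset.mem_univ v) hv) h
    exact (gammaC_le P c hR₁ hR₂ (hI'.trans_le hQ) T).trans hc'.le

variable {n : ℕ} {R₁ R₂ : ℝ}

lemma lawUV_eq_codeLaw_comp_right (P : stdSimplex ℝ U) (σ : EncStrat U n R₁)
    (μ : RelayStrat n R₁ R₂) (τ : DecStrat V n R₂) (u : Fin n → U) (v : Fin n → V) :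
    lawUV P σ μ τ u v = codeLaw P σ (Channel.comp μ τ) u v := by
  simp only [lawUV, jointLaw, codeLaw, Channel.comp, Finset.mul_sum, mul_assoc]

lemma lawUV_eq_codeLaw_comp_left (P : stdSimplex ℝ U) (σ : EncStrat U n R₁)
    (μ : RelayStrat n R₁ R₂) (τ : DecStrat V n R₂) (u : Fin n → U) (v : Fin n → V) :
    lawUV P σ μ τ u v = codeLaw P (Channel.comp σ μ) τ u v := by
  simp only [lawUV, jointLaw, codeLaw, Channel.comp, Finset.mul_sum, Finset.sum_mul, mul_assoc]
  exact Finset.sum_comm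

lemma natInfo_le_of_card_msg {P : stdSimplex ℝ U} {Q : Channel U V} {R : ℝ} (hR : 0 ≤ R)
    (hn : 0 < n) (h : n * natInfo P Q ≤ Real.log (Fintype.card (Msg n R))) :
    natInfo P Q ≤ R * Real.log 2 := by
  have hn' : (0 : ℝ) < n := by exact_mod_cast hn
  rw [Fintype.card_fin, Nat.cast_pow, Nat.cast_ofNat, Real.log_pow] at h
  have h1 : (⌊(n : ℝ) * R⌋₊ : ℝ) * Real.log 2 ≤ n * R * Real.log 2 :=
    mul_le_mul_of_nonneg_right (Nat.floor_le (by positivity)) (Real.log_nonneg one_le_two)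
  refine le_of_mul_le_mul_left ?_ hn'
  linarith

/-- The cascade is cut at its slower link: the relay is absorbed into the decoder if that is the
first link, into the encoder if it is the second. -/
lemma gammaC_le_longRunCost
    (hW : min (Fintype.card U + 1) (Fintype.card V) ≤ Fintype.card W)
    [Nonempty V] [Nonempty W] (P : stdSimplex ℝ U) (c : U → V → ℝ) (hR₁ : 0 ≤ R₁) (hR₂ : 0 ≤ R₂)
    (hn : 0 < n) (σ : EncStrat U n R₁) (μ : RelayStrat n R₁ R₂) (τ : DecStrat V n R₂) :
    gammaC W P c c R₁ R₂ ≤ longRunCost P c σ μ τ := by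
  rcases le_total R₁ R₂ with h | h
  · obtain ⟨Q, hI, hc⟩ := exists_singleLetter_channel P hn σ (Channel.comp μ τ)
    have := gammaC_le_directCost hW P c hR₁ hR₂ Q
      (by rw [min_eq_left h]; exact natInfo_le_of_card_msg hR₁ hn hI)
    rw [directCost, ← hc c] at this
    simpa only [longRunCost, lawUV_eq_codeLaw_comp_right] using this
  · obtain ⟨Q, hI, hc⟩ := exists_singleLetter_channel P hn (Channel.comp σ μ) τ
    have := gammaC_le_directCost hW P c hR₁ hR₂ Q
      (by rw [min_eq_right h]; exact natInfo_le_of_card_msg hR₂ hn hI)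
    rw [directCost, ← hc c] at this
    simpa only [longRunCost, lawUV_eq_codeLaw_comp_left] using this

end ConverseBound

/-! ### Weak law of large numbers -/

section LargeNumbers

variable {X : Type*} [Fintype X]

lemma sum_prod_law_mul_sq (p : X → ℝ) (hp : ∑ a, p a = 1) (g : X → ℝ)
    (hg : ∑ a, p a * g a = 0) (n : ℕ) :
    ∑ x : Fin n → X, (∏ t, p (x t)) * (∑ t, g (x t)) ^ 2 = n * ∑ a, p a * g a ^ 2 := by
  induction n with
  | zero => simp
  | succ n ih =>
    have hcross : ∑ x : Fin n → X, (∏ t, p (x t)) * ∑ t, g (x t) = 0 := by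
      simp_rw [Finset.mul_sum]
      rw [Finset.sum_comm]
      simp [sum_prod_law_mul p hp g, hg]
    rw [← (Fin.consEquiv fun _ => X).sum_comp, Fintype.sum_prod_type]
    have h : ∀ (a : X) (x : Fin n → X),
        (∏ t, p ((Fin.consEquiv fun _ => X) (a, x) t)) *
          (∑ t, g ((Fin.consEquiv fun _ => X) (a, x) t)) ^ 2 =
        p a * g a ^ 2 * (∏ t, p (x t)) + 2 * (p a * g a) * ((∏ t, p (x t)) * ∑ t, g (x t)) +
          p a * ((∏ t, p (x t)) * (∑ t, g (x t)) ^ 2) := fun a x => by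
      simp only [Fin.consEquiv_apply, Fin.prod_univ_succ, Fin.sum_univ_succ, Fin.cons_zero,
        Fin.cons_succ]
      ring
    simp_rw [h, Finset.sum_add_distrib, ← Finset.mul_sum, hcross, ih, sum_prod_law p hp]
    simp_rw [mul_zero, Finset.sum_const_zero, ← Finset.sum_mul, hp]
    push_cast
    ring

/-- Chebyshev's inequality for the empirical mean of an i.i.d. sequence. -/
lemma sum_prod_law_deviation_le (p : X → ℝ) (hp0 : ∀ a, 0 ≤ p a) (hp : ∑ a, p a = 1) (g : X → ℝ)
    {n : ℕ} (hn : 0 < n) {ε : ℝ} (hε : 0 < ε) :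
    (∑ x : Fin n → X, (∏ t, p (x t)) *
      if n * ((∑ a, p a * g a) + ε) < ∑ t, g (x t) then (1 : ℝ) else 0) ≤
      (∑ a, p a * (g a - ∑ b, p b * g b) ^ 2) / ε ^ 2 / n := by
  set m := ∑ a, p a * g a with hm
  have hn' : (0 : ℝ) < n := by exact_mod_cast hn
  have h0 : ∑ a, p a * (g a - m) = 0 := by
    simp_rw [mul_sub, Finset.sum_sub_distrib, ← Finset.sum_mul, hp, ← hm, one_mul, sub_self]
  have hvar := sum_prod_law_mul_sq p hp (fun a => g a - m) h0 n
  have hnε : 0 < n * ε := mul_pos hn' hε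
  calc _ ≤ ∑ x : Fin n → X, ((∏ t, p (x t)) * (∑ t, (g (x t) - m)) ^ 2) / (n * ε) ^ 2 := by
        refine Finset.sum_le_sum fun x _ => ?_
        rw [mul_div_assoc]
        refine mul_le_mul_of_nonneg_left ?_ (Finset.prod_nonneg fun t _ => hp0 _)
        split_ifs with h
        · rw [one_le_div (by positivity)]
          refine pow_le_pow_left₀ hnε.le ?_ 2
          rw [Finset.sum_sub_distrib, Finset.sum_const, Finset.card_univ, Fintype.card_fin,
            nsmul_eq_mul]
          linarith
        · positivity
    _ = _ := by
        rw [← Finset.sum_div, hvar]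
        field_simp

end LargeNumbers

/-- From `1 - x ≤ exp (-(s * y))`, the power is at most `exp (-(K * s * y))`, which lies below the
chord of the exponential between `0` and `-(K * s)`. In use, `x` is the chance that a random code
word is good, `y` the same chance under the test channel, and `s` the price of changing measure. -/
lemma one_sub_pow_le {x y s : ℝ} (hx : x ≤ 1) (hy0 : 0 ≤ y) (hy1 : y ≤ 1) (h : s * y ≤ x)
    (K : ℕ) : (1 - x) ^ K ≤ 1 - y + Real.exp (-(K * s)) := by
  have h1 : (1 - x) ^ K ≤ Real.exp (-(s * y)) ^ K := by
    refine pow_le_pow_left₀ (by linarith) ?_ K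
    have := Real.add_one_le_exp (-(s * y))
    linarith
  rw [← Real.exp_nat_mul] at h1
  have h2 := convexOn_exp.2 (Set.mem_univ 0) (Set.mem_univ (-(K * s)))
    (sub_nonneg.2 hy1) hy0 (by ring)
  simp only [smul_eq_mul, mul_zero, zero_add, Real.exp_zero, mul_one] at h2
  have h3 : (K : ℝ) * -(s * y) = y * -(K * s) := by ring
  rw [h3] at h1
  have h4 := mul_le_of_le_one_left (Real.exp_pos (-(K * s))).le hy1
  linarith

/-! ### Random code books -/

section RandomCoding

variable {U W : Type*} [Fintype U] [Fintype W] {n : ℕ}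

lemma sum_outputLaw (P : stdSimplex ℝ U) (Q : Channel U W) : ∑ w, outputLaw P Q w = 1 := by
  simp_rw [outputLaw]
  rw [Finset.sum_comm]
  simp_rw [← Finset.mul_sum, (Q _).2.2, mul_one]
  exact P.2.2

/-- The probability that a random code word falls in a set of words with small information density
is not much smaller than the conditional probability of this set. -/
lemma exp_neg_mul_sum_le (P : stdSimplex ℝ U) (Q : Channel U W) {b : ℝ} (u : Fin n → U)
    (hu : 0 < ∏ t, P.1 (u t)) (G : (Fin n → W) → Prop) [DecidablePred G]
    (hG : ∀ w, G w → ∑ t, Real.log ((Q (u t)).1 (w t) / outputLaw P Q (w t)) ≤ b) :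
    Real.exp (-b) * ∑ w : Fin n → W, (∏ t, (Q (u t)).1 (w t)) * (if G w then 1 else 0) ≤
      ∑ w : Fin n → W, (∏ t, outputLaw P Q (w t)) * (if G w then 1 else 0) := by
  have hu' : ∀ t, 0 < P.1 (u t) := fun t => lt_of_le_of_ne (P.2.1 _) fun h =>
    hu.ne' (Finset.prod_eq_zero (Finset.mem_univ t) h.symm)
  rw [Finset.mul_sum]
  refine Finset.sum_le_sum fun w _ => ?_
  split_ifs with h
  · rw [mul_one, mul_one]
    rcases (Finset.prod_nonneg fun t (_ : t ∈ Finset.univ) => (Q (u t)).2.1 (w t)).eq_or_lt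
      with h0 | h0
    · rw [← h0, mul_zero]
      exact Finset.prod_nonneg fun t _ => outputLaw_nonneg P Q _
    · have hQ : ∀ t, 0 < (Q (u t)).1 (w t) := fun t => lt_of_le_of_ne ((Q _).2.1 _) fun h =>
        h0.ne' (Finset.prod_eq_zero (Finset.mem_univ t) h.symm)
      have hq : ∀ t, 0 < outputLaw P Q (w t) := fun t =>
        outputLaw_pos P Q (mul_pos (hu' t) (hQ t))
      have h1 := Real.exp_le_exp.2 (hG w h)
      rw [Real.exp_sum, Finset.prod_congr rfl fun t _ => Real.exp_log (div_pos (hQ t) (hq t)),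
        Finset.prod_div_distrib, div_le_iff₀ (Finset.prod_pos fun t _ => hq t)] at h1
      calc _ ≤ Real.exp (-b) * (Real.exp b * ∏ t, outputLaw P Q (w t)) :=
            mul_le_mul_of_nonneg_left h1 (Real.exp_pos _).le
        _ = _ := by rw [← mul_assoc, ← Real.exp_add, neg_add_cancel, Real.exp_zero, one_mul]
  · simp

/-- The probability that no word of a random code book is good. -/
lemma sum_codebook_eq (q : (Fin n → W) → ℝ) (K : ℕ) (G : (Fin n → W) → Prop) [DecidablePred G] :
    (∑ C : Fin K → Fin n → W, (∏ m, q (C m)) * if ∃ m, G (C m) then (0 : ℝ) else 1) =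
      (∑ w, q w * if G w then 0 else 1) ^ K := by
  have h : ∀ C : Fin K → Fin n → W, ((∏ m, q (C m)) * if ∃ m, G (C m) then (0 : ℝ) else 1) =
      ∏ m, (q (C m) * if G (C m) then 0 else 1) := fun C => by
    rw [Finset.prod_mul_distrib]
    congr 1
    split_ifs with h
    · obtain ⟨m, hm⟩ := h
      exact (Finset.prod_eq_zero (Finset.mem_univ m) (by simp [hm])).symm
    · rw [not_exists] at h
      simp [h]
  simp_rw [h]
  rw [← Fintype.prod_sum fun (_ : Fin K) w => q w * if G w then (0 : ℝ) else 1]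
  simp

lemma sum_ite_not {A : Type*} [Fintype A] (p : A → ℝ) (hp : ∑ a, p a = 1) (G : A → Prop)
    [DecidablePred G] :
    (∑ a, p a * if G a then (0 : ℝ) else 1) = 1 - ∑ a, p a * if G a then 1 else 0 := by
  rw [eq_sub_iff_add_eq, ← Finset.sum_add_distrib]
  refine (Finset.sum_congr rfl fun a _ => ?_).trans hp
  split_ifs <;> simp

/-- Code words are drawn independently from the product output law. For each source word
`one_sub_pow_le` bounds the chance that none is good; averaging over source words bounds the mean
failure probability, and some code book does no worse than the mean. -/
lemma exists_codebook (P : stdSimplex ℝ U) (Q : Channel U W) (b : ℝ) (K : ℕ)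
    (G : (Fin n → U) → (Fin n → W) → Prop) [∀ u, DecidablePred (G u)]
    (hG : ∀ u w, G u w → ∑ t, Real.log ((Q (u t)).1 (w t) / outputLaw P Q (w t)) ≤ b) :
    ∃ C : Fin K → Fin n → W,
      (∑ u, (∏ t, P.1 (u t)) * if ∃ m, G u (C m) then (0 : ℝ) else 1) ≤
        (∑ u : Fin n → U, ∑ w : Fin n → W, (∏ t, P.1 (u t) * (Q (u t)).1 (w t)) *
          if G u w then (0 : ℝ) else 1) + Real.exp (-(K * Real.exp (-b))) := by
  set q : (Fin n → W) → ℝ := fun w => ∏ t, outputLaw P Q (w t) with hq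
  have hq1 : ∑ w, q w = 1 := sum_prod_law _ (sum_outputLaw P Q) n
  have hq0 : ∀ w, 0 ≤ q w := fun w => Finset.prod_nonneg fun t _ => outputLaw_nonneg P Q _
  have hP0 : ∀ u : Fin n → U, 0 ≤ ∏ t, P.1 (u t) := fun u => Finset.prod_nonneg fun t _ => P.2.1 _
  have hC1 : ∑ C : Fin K → Fin n → W, ∏ m, q (C m) = 1 := sum_prod_law q hq1 K
  set B := (∑ u : Fin n → U, ∑ w : Fin n → W, (∏ t, P.1 (u t) * (Q (u t)).1 (w t)) *
          if G u w then (0 : ℝ) else 1) + Real.exp (-(K * Real.exp (-b))) with hB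
  by_contra! hcon
  have hfail : ∀ u : Fin n → U, (∏ t, P.1 (u t)) *
      (∑ C : Fin K → Fin n → W, (∏ m, q (C m)) * if ∃ m, G u (C m) then (0 : ℝ) else 1) ≤
      (∏ t, P.1 (u t)) * ((∑ w : Fin n → W, (∏ t, (Q (u t)).1 (w t)) *
        if G u w then (0 : ℝ) else 1) + Real.exp (-(K * Real.exp (-b)))) := fun u => by
    rcases (hP0 u).eq_or_lt with h | h
    · rw [← h, zero_mul, zero_mul]
    · refine mul_le_mul_of_nonneg_left ?_ (hP0 u)
      have hQ1 : ∑ w : Fin n → W, ∏ t, (Q (u t)).1 (w t) = 1 := by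
        rw [← Fintype.prod_sum fun t a => (Q (u t)).1 a]
        simp [(Q _).2.2]
      have hQ0 : ∀ w : Fin n → W, 0 ≤ ∏ t, (Q (u t)).1 (w t) := fun w =>
        Finset.prod_nonneg fun t _ => (Q _).2.1 _
      have hind : ∀ w, (if G u w then (1 : ℝ) else 0) ≤ 1 := fun w => by split_ifs <;> simp
      rw [sum_codebook_eq q K (G u), sum_ite_not q hq1, sum_ite_not _ hQ1]
      refine one_sub_pow_le ?_ ?_ ?_ (exp_neg_mul_sum_le P Q u h (G u) (hG u)) K
      · exact (Finset.sum_le_sum fun w _ =>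
          mul_le_of_le_one_right (hq0 w) (hind w)).trans_eq hq1
      · exact Finset.sum_nonneg fun w _ => mul_nonneg (hQ0 w) (by split_ifs <;> simp)
      · exact (Finset.sum_le_sum fun w _ =>
          mul_le_of_le_one_right (hQ0 w) (hind w)).trans_eq hQ1
  have havg : ∑ C : Fin K → Fin n → W, (∏ m, q (C m)) *
      (∑ u, (∏ t, P.1 (u t)) * if ∃ m, G u (C m) then (0 : ℝ) else 1) ≤ B := by
    calc _ = ∑ u : Fin n → U, (∏ t, P.1 (u t)) * (∑ C : Fin K → Fin n → W, (∏ m, q (C m)) *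
          if ∃ m, G u (C m) then (0 : ℝ) else 1) := by
          simp_rw [Finset.mul_sum]
          rw [Finset.sum_comm]
          simp_rw [mul_left_comm]
      _ ≤ _ := Finset.sum_le_sum fun u _ => hfail u
      _ = B := by
          simp_rw [mul_add, Finset.sum_add_distrib, ← Finset.sum_mul, sum_prod_law P.1 P.2.2,
            one_mul, hB, Finset.prod_mul_distrib, Finset.mul_sum, mul_assoc]
  have hlt : B < ∑ C : Fin K → Fin n → W, (∏ m, q (C m)) *
      (∑ u, (∏ t, P.1 (u t)) * if ∃ m, G u (C m) then (0 : ℝ) else 1) := by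
    have hCnn : ∀ C : Fin K → Fin n → W, 0 ≤ ∏ m, q (C m) := fun C =>
      Finset.prod_nonneg fun m _ => hq0 _
    have hB1 : B = ∑ C : Fin K → Fin n → W, (∏ m, q (C m)) * B := by
      rw [← Finset.sum_mul, hC1, one_mul]
    -- A code book of positive probability is needed to make the averaged inequality strict.
    obtain ⟨C₀, -, hC₀⟩ : ∃ C ∈ (Finset.univ : Finset (Fin K → Fin n → W)),
        0 < ∏ m, q (C m) := by
      refine Finset.exists_lt_of_sum_lt (f := fun _ => (0 : ℝ)) ?_
      rw [Finset.sum_const_zero, hC1]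
      exact one_pos
    rw [hB1]
    refine Finset.sum_lt_sum (fun C _ => mul_le_mul_of_nonneg_left (hcon C).le (hCnn C))
      ⟨C₀, Finset.mem_univ _, mul_lt_mul_of_pos_left (hcon C₀) hC₀⟩
  exact absurd havg (not_le.2 hlt)

/-- The probability of a word pair with atypically large mean of `g`. -/
lemma sum_pair_deviation_le (P : stdSimplex ℝ U) (Q : Channel U W) (g : U → W → ℝ)
    (hn : 0 < n) {ε : ℝ} (hε : 0 < ε) :
    (∑ u : Fin n → U, ∑ w : Fin n → W, (∏ t, P.1 (u t) * (Q (u t)).1 (w t)) *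
      if n * (directCost P g Q + ε) < ∑ t, g (u t) (w t)
        then (1 : ℝ) else 0) ≤
      (∑ a, ∑ b, P.1 a * (Q a).1 b *
        (g a b - directCost P g Q) ^ 2) / ε ^ 2 / n := by
  have hp : ∑ x : U × W, P.1 x.1 * (Q x.1).1 x.2 = 1 := by
    rw [Fintype.sum_prod_type]
    simp_rw [← Finset.mul_sum, (Q _).2.2, mul_one]
    exact P.2.2
  have h := sum_prod_law_deviation_le (fun x : U × W => P.1 x.1 * (Q x.1).1 x.2)
    (fun x => mul_nonneg (P.2.1 _) ((Q _).2.1 _)) hp (fun x => g x.1 x.2) hn hε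
  rw [← (Equiv.arrowProdEquivProdArrow (Fin n) (fun _ => U) (fun _ => W)).symm.sum_comp,
    Fintype.sum_prod_type] at h
  simp only [Fintype.sum_prod_type] at h
  exact h

/-- Random coding bound for source coding with a fidelity criterion. -/
lemma exists_code_of_channel (P : stdSimplex ℝ U) (Q : Channel U W) (d : U → W → ℝ) {ε : ℝ}
    (hε : 0 < ε) :
    ∃ A L : ℝ, ∀ n K : ℕ, 0 < n → 0 < K →
      ∃ (e : (Fin n → U) → Fin K) (C : Fin K → Fin n → W),
        ∑ u : Fin n → U, (∏ t, P.1 (u t)) * (1 / (n : ℝ) * ∑ t, d (u t) (C (e u) t)) ≤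
          directCost P d Q + ε +
            L * (A / n + Real.exp (-(K * Real.exp (-(n * (natInfo P Q + ε)))))) := by
  classical
  set D := directCost P d Q with hD
  set i : U → W → ℝ := fun a b => Real.log ((Q a).1 b / outputLaw P Q b) with hi
  obtain ⟨M, hM0, hM⟩ : ∃ M : ℝ, 0 ≤ M ∧ ∀ a b, d a b ≤ M := by
    refine ⟨∑ a, ∑ b, |d a b|, Finset.sum_nonneg fun a _ => Finset.sum_nonneg fun b _ =>
      abs_nonneg _, fun a b => (le_abs_self _).trans ?_⟩
    refine (Finset.single_le_sum (f := fun b => |d a b|) (fun b _ => abs_nonneg _)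
      (Finset.mem_univ b)).trans ?_
    exact Finset.single_le_sum (f := fun a => ∑ b, |d a b|)
      (fun a _ => Finset.sum_nonneg fun b _ => abs_nonneg _) (Finset.mem_univ a)
  -- `A` collects the Chebyshev constants of the cost and of the information density; `L` bounds the
  -- excess of any cost over `D + ε`.
  refine ⟨(∑ a, ∑ b, P.1 a * (Q a).1 b * (d a b - D) ^ 2) / ε ^ 2 +
    (∑ a, ∑ b, P.1 a * (Q a).1 b * (i a b - natInfo P Q) ^ 2) / ε ^ 2, M + |D + ε|,
    fun n K hn hK => ?_⟩
  have hn' : (0 : ℝ) < n := by exact_mod_cast hn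
  let G : (Fin n → U) → (Fin n → W) → Prop := fun u w =>
    ∑ t, d (u t) (w t) ≤ n * (D + ε) ∧ ∑ t, i (u t) (w t) ≤ n * (natInfo P Q + ε)
  obtain ⟨C, hC⟩ := exists_codebook P Q (n * (natInfo P Q + ε)) K G fun u w h => h.2
  have hbad : (∑ u : Fin n → U, ∑ w : Fin n → W, (∏ t, P.1 (u t) * (Q (u t)).1 (w t)) *
      if G u w then (0 : ℝ) else 1) ≤
      ((∑ a, ∑ b, P.1 a * (Q a).1 b * (d a b - D) ^ 2) / ε ^ 2 +
        (∑ a, ∑ b, P.1 a * (Q a).1 b * (i a b - natInfo P Q) ^ 2) / ε ^ 2) / n := by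
    have hI : natInfo P Q = directCost P i Q := rfl
    have hdev := sum_pair_deviation_le P Q i hn hε
    rw [← hI] at hdev
    rw [add_div]
    refine le_trans ?_ (add_le_add (sum_pair_deviation_le P Q d hn hε) hdev)
    simp_rw [← Finset.sum_add_distrib, ← mul_add]
    refine Finset.sum_le_sum fun u _ => Finset.sum_le_sum fun w _ => mul_le_mul_of_nonneg_left ?_
      (Finset.prod_nonneg fun t _ => mul_nonneg (P.2.1 _) ((Q _).2.1 _))
    by_cases h1 : ∑ t, d (u t) (w t) ≤ n * (D + ε)
    · by_cases h2 : ∑ t, i (u t) (w t) ≤ n * (natInfo P Q + ε)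
      · rw [if_pos ⟨h1, h2⟩]
        positivity
      · rw [if_neg fun h => h2 h.2]
        refine le_add_of_nonneg_of_le (by positivity) ?_
        rw [if_pos (not_le.1 h2)]
    · rw [if_neg fun h => h1 h.1]
      refine le_add_of_le_of_nonneg ?_ (by positivity)
      rw [if_pos (not_le.1 h1)]
  -- When no code word is good the encoder sends index `0`, which exists because `K` is positive.
  let e : (Fin n → U) → Fin K := fun u =>
    if h : ∃ m, G u (C m) then h.choose else ⟨0, hK⟩
  refine ⟨e, C, ?_⟩
  have hpoint : ∀ u : Fin n → U, 1 / (n : ℝ) * ∑ t, d (u t) (C (e u) t) ≤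
      D + ε + (M + |D + ε|) * if ∃ m, G u (C m) then (0 : ℝ) else 1 := fun u => by
    rw [one_div, inv_mul_le_iff₀ hn']
    split_ifs with h
    · have he : e u = h.choose := by simp only [e, h, dite_true]
      rw [he, mul_zero, add_zero]
      exact h.choose_spec.1
    · have h1 : ∑ t, d (u t) (C (e u) t) ≤ n * M := by
        refine (Finset.sum_le_sum fun t _ => hM _ _).trans_eq ?_
        simp
      refine h1.trans (mul_le_mul_of_nonneg_left ?_ hn'.le)
      have := neg_abs_le (D + ε)
      linarith
  calc _ ≤ ∑ u : Fin n → U, (∏ t, P.1 (u t)) *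
        (D + ε + (M + |D + ε|) * if ∃ m, G u (C m) then (0 : ℝ) else 1) :=
        Finset.sum_le_sum fun u _ => mul_le_mul_of_nonneg_left (hpoint u)
          (Finset.prod_nonneg fun t _ => P.2.1 _)
    _ = D + ε + (M + |D + ε|) * ∑ u : Fin n → U, (∏ t, P.1 (u t)) *
        if ∃ m, G u (C m) then (0 : ℝ) else 1 := by
        simp_rw [mul_add, Finset.sum_add_distrib, ← Finset.sum_mul, sum_prod_law P.1 P.2.2,
          one_mul, Finset.mul_sum, mul_left_comm]
    _ ≤ _ := by
        refine add_le_add_right (mul_le_mul_of_nonneg_left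
          (hC.trans (add_le_add_left hbad _)) (by positivity)) _

end RandomCoding

/-! ### Achievability for the cascade -/

section Achievability

variable {U V W : Type*} [Fintype U] [Fintype V] [Fintype W]

/-- The `K` indices embed in both message sets, and the relay translates one embedding into the
other. -/
lemma gammaN_le_of_code [Nonempty V] (P : stdSimplex ℝ U) (c : U → V → ℝ) {R₁ R₂ : ℝ} {n K : ℕ}
    (hK : 0 < K) (h₁ : K ≤ 2 ^ ⌊(n : ℝ) * R₁⌋₊) (h₂ : K ≤ 2 ^ ⌊(n : ℝ) * R₂⌋₊)
    (e : (Fin n → U) → Fin K) (g : Fin K → Fin n → V) :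
    gammaN P c c c R₁ R₂ n ≤
      ∑ u : Fin n → U, (∏ t, P.1 (u t)) * (1 / (n : ℝ) * ∑ t, c (u t) (g (e u) t)) := by
  classical
  have : Nonempty (Fin K) := ⟨⟨0, hK⟩⟩
  let i₁ : Fin K → Msg n R₁ := Fin.castLE h₁
  let i₂ : Fin K → Msg n R₂ := Fin.castLE h₂
  have hi₁ : ∀ m, Function.invFun i₁ (i₁ m) = m :=
    Function.leftInverse_invFun (Fin.castLE_injective h₁)
  have hi₂ : ∀ m, Function.invFun i₂ (i₂ m) = m :=
    Function.leftInverse_invFun (Fin.castLE_injective h₂)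
  refine (gammaN_le P c (fun u => pointMass (i₁ (e u)))
    (fun m => pointMass (i₂ (Function.invFun i₁ m)))
    (fun m => pointMass (g (Function.invFun i₂ m)))).trans_eq ?_
  have hlaw : ∀ u v, lawUV P (fun u => pointMass (i₁ (e u)))
      (fun m => pointMass (i₂ (Function.invFun i₁ m)))
      (fun m => pointMass (g (Function.invFun i₂ m))) u v =
      if v = g (e u) then ∏ t, P.1 (u t) else 0 := fun u v => by
    simp only [lawUV, jointLaw, pointMass_apply, mul_ite, mul_one, mul_zero]
    rw [Finset.sum_eq_single (i₁ (e u)), Finset.sum_eq_single (i₂ (e u))]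
    · simp [hi₁, hi₂]
    · intro m _ hm
      simp [hi₁, hm]
    · simp
    · intro m _ hm
      simp [hm]
    · simp
  simp only [longRunCost, hlaw, ite_mul, zero_mul, Finset.sum_ite_eq', Finset.mem_univ, if_true]

/-- The cost is linear in each law `T w`, so replacing that law by a point mass at a best letter
does not increase it. -/
lemma exists_function_directCost_le [Nonempty V] (P : stdSimplex ℝ U) (c : U → V → ℝ)
    (Q : Channel U W) (T : Channel W V) :
    ∃ f : W → V, directCost P (fun u w => c u (f w)) Q ≤ expCost P c Q T := by
  choose f hf using fun w : W => Finite.exists_min fun v => ∑ u, P.1 u * (Q u).1 w * c u v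
  refine ⟨f, ?_⟩
  rw [directCost, expCost, Finset.sum_comm]
  conv_rhs => rw [Finset.sum_comm]
  refine Finset.sum_le_sum fun w _ => ?_
  calc _ = ∑ v, (T w).1 v * ∑ u, P.1 u * (Q u).1 w * c u (f w) := by
        rw [← Finset.sum_mul, (T w).2.2, one_mul]
    _ ≤ ∑ v, (T w).1 v * ∑ u, P.1 u * (Q u).1 w * c u v :=
        Finset.sum_le_sum fun v _ => mul_le_mul_of_nonneg_left (hf w v) ((T w).2.1 v)
    _ = _ := by
        rw [Finset.sum_comm]
        refine Finset.sum_congr rfl fun v _ => ?_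
        rw [Finset.mul_sum]
        refine Finset.sum_congr rfl fun u _ => by ring

lemma exp_le_card_msg {R : ℝ} (n : ℕ) :
    Real.exp (n * (R * Real.log 2)) ≤ 2 * ((2 ^ ⌊(n : ℝ) * R⌋₊ : ℕ) : ℝ) := by
  have h : (n : ℝ) * R ≤ ((⌊(n : ℝ) * R⌋₊ + 1 : ℕ) : ℝ) := by
    push_cast
    exact (Nat.lt_floor_add_one _).le
  have h2 : Real.exp ((⌊(n : ℝ) * R⌋₊ + 1 : ℕ) * Real.log 2) =
      2 * ((2 ^ ⌊(n : ℝ) * R⌋₊ : ℕ) : ℝ) := by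
    rw [Real.exp_nat_mul, Real.exp_log two_pos, pow_succ']
    push_cast
    rfl
  rw [← h2, ← mul_assoc]
  exact Real.exp_le_exp.2 (mul_le_mul_of_nonneg_right h (Real.log_nonneg one_le_two))

/-- Achievability for test channels of rate strictly below the capacity of both links. -/
lemma eventually_gammaN_lt [Nonempty V] (P : stdSimplex ℝ U) (c : U → V → ℝ) {R₁ R₂ : ℝ}
    (Q : Channel U W) (f : W → V) (hQ : natInfo P Q < min R₁ R₂ * Real.log 2) {b : ℝ}
    (hb : directCost P (fun u w => c u (f w)) Q < b) :
    ∀ᶠ n : ℕ in atTop, gammaN P c c c R₁ R₂ n < b := by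
  set R := min R₁ R₂ with hR
  set D := directCost P (fun u w => c u (f w)) Q with hD
  -- One `ε` of rate slack pays for fluctuations of the information density; the other makes the
  -- exponent in the failure bound grow.
  obtain ⟨ε, hε, hε1, hε2⟩ : ∃ ε > 0, D + ε < b ∧ natInfo P Q + 2 * ε ≤ R * Real.log 2 := by
    refine ⟨min ((b - D) / 2) ((R * Real.log 2 - natInfo P Q) / 2), lt_min ?_ ?_, ?_, ?_⟩
    · linarith
    · linarith
    · have := min_le_left ((b - D) / 2) ((R * Real.log 2 - natInfo P Q) / 2)
      linarith
    · have := min_le_right ((b - D) / 2) ((R * Real.log 2 - natInfo P Q) / 2)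
      linarith
  obtain ⟨A, L, hcode⟩ := exists_code_of_channel P Q (fun u w => c u (f w)) hε
  set K : ℕ → ℕ := fun n => 2 ^ ⌊(n : ℝ) * R⌋₊ with hK
  have hexp : Tendsto (fun n : ℕ =>
      Real.exp (-((K n : ℝ) * Real.exp (-(n * (natInfo P Q + ε)))))) atTop (𝓝 0) := by
    refine Real.tendsto_exp_neg_atTop_nhds_zero.comp ?_
    -- The exponent is at least `exp (n * ε) / 2`, the factor two being lost to the floor in the
    -- message count.
    refine tendsto_atTop_mono (f := fun n : ℕ => (n : ℝ) * (ε / 2)) (fun n => ?_)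
      (tendsto_natCast_atTop_atTop.atTop_mul_const (half_pos hε))
    have h1 := exp_le_card_msg (R := R) n
    have h2 : Real.exp (n * ε) ≤ Real.exp (n * (R * Real.log 2)) *
        Real.exp (-(n * (natInfo P Q + ε))) := by
      rw [← Real.exp_add]
      refine Real.exp_le_exp.2 ?_
      have := mul_le_mul_of_nonneg_left hε2 (Nat.cast_nonneg (α := ℝ) n)
      linarith
    have h3 := mul_le_mul_of_nonneg_right h1 (Real.exp_pos (-(n * (natInfo P Q + ε)))).le
    have h4 := Real.add_one_le_exp (n * ε)
    simp only [hK]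
    linarith
  have hbound : Tendsto (fun n : ℕ => D + ε +
      L * (A / n + Real.exp (-((K n : ℝ) * Real.exp (-(n * (natInfo P Q + ε))))))) atTop
      (𝓝 (D + ε + L * (0 + 0))) :=
    (((tendsto_const_div_atTop_nhds_zero_nat A).add hexp).const_mul L).const_add _
  rw [add_zero, mul_zero, add_zero] at hbound
  filter_upwards [hbound.eventually_lt_const hε1, eventually_gt_atTop 0] with n hn hn0
  obtain ⟨e, C, hC⟩ := hcode n (K n) hn0 (by positivity)
  have hle : ∀ R', R ≤ R' → K n ≤ 2 ^ ⌊(n : ℝ) * R'⌋₊ := fun R' h =>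
    Nat.pow_le_pow_right two_pos (Nat.floor_mono
      (mul_le_mul_of_nonneg_left h (Nat.cast_nonneg n)))
  exact ((gammaN_le_of_code P c (by positivity) (hle R₁ (min_le_left _ _))
    (hle R₂ (min_le_right _ _)) e fun m t => f (C m t)).trans hC).trans_lt hn

/-- The output law of a channel as an element of the simplex. -/
def outputDist (P : stdSimplex ℝ U) (Q : Channel U W) : stdSimplex ℝ W :=
  ⟨outputLaw P Q, outputLaw_nonneg P Q, sum_outputLaw P Q⟩

/-- The mixture of a channel and its output law, with weight `a` on the latter. -/
def mixOutput (P : stdSimplex ℝ U) (Q : Channel U W) (a : ℝ) (ha0 : 0 ≤ a) (ha1 : a ≤ 1) :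
    Channel U W := fun u =>
  ⟨(1 - a) • (Q u).1 + a • outputLaw P Q,
    convex_stdSimplex ℝ W (Q u).2 (outputDist P Q).2 (sub_nonneg.2 ha1) ha0 (by ring)⟩

lemma mixOutput_apply (P : stdSimplex ℝ U) (Q : Channel U W) (a : ℝ) (ha0 : 0 ≤ a) (ha1 : a ≤ 1)
    (u : U) (w : W) :
    (mixOutput P Q a ha0 ha1 u).1 w = (1 - a) * (Q u).1 w + a * outputLaw P Q w := rfl

lemma outputLaw_mixOutput (P : stdSimplex ℝ U) (Q : Channel U W) (a : ℝ) (ha0 : 0 ≤ a)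
    (ha1 : a ≤ 1) (w : W) : outputLaw P (mixOutput P Q a ha0 ha1) w = outputLaw P Q w := by
  have h : outputLaw P (mixOutput P Q a ha0 ha1) w =
      (1 - a) * outputLaw P Q w + a * outputLaw P Q w := by
    conv_lhs => rw [outputLaw]
    simp_rw [mixOutput_apply, mul_add, Finset.sum_add_distrib, ← Finset.sum_mul, P.2.2, one_mul,
      mul_left_comm, ← Finset.mul_sum]
    rfl
  rw [h]
  ring

/-- The output law is preserved, so each likelihood ratio moves linearly towards one; `x * log x` is
convex and vanishes there. -/
lemma natInfo_mixOutput_le (P : stdSimplex ℝ U) (Q : Channel U W) (a : ℝ) (ha0 : 0 ≤ a)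
    (ha1 : a ≤ 1) : natInfo P (mixOutput P Q a ha0 ha1) ≤ (1 - a) * natInfo P Q := by
  rw [natInfo, natInfo, Finset.mul_sum]
  refine Finset.sum_le_sum fun u _ => ?_
  rw [Finset.mul_sum]
  refine Finset.sum_le_sum fun w _ => ?_
  rw [outputLaw_mixOutput, mixOutput_apply]
  set q := outputLaw P Q w with hq
  rcases (outputLaw_nonneg P Q w).eq_or_lt with h | h
  · rw [← hq] at h
    simp [← h]
  · rw [← hq] at h
    have hcx := Real.convexOn_mul_log.2 (Set.mem_Ici.2 (div_nonneg ((Q u).2.1 w) h.le))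
      (Set.mem_Ici.2 zero_le_one) (sub_nonneg.2 ha1) ha0 (by ring)
    simp only [smul_eq_mul, Real.log_one, mul_zero, mul_one, add_zero] at hcx
    have hmul := mul_le_mul_of_nonneg_left hcx (mul_nonneg (P.2.1 u) h.le)
    have h1 : ((1 - a) * (Q u).1 w + a * q) / q = (1 - a) * ((Q u).1 w / q) + a := by
      field_simp
    rw [h1]
    refine Eq.trans_le ?_ (hmul.trans_eq ?_)
    · have : (1 - a) * (Q u).1 w + a * q = q * ((1 - a) * ((Q u).1 w / q) + a) := by field_simp
      rw [this]
      ring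
    · have : (Q u).1 w = q * ((Q u).1 w / q) := by field_simp
      generalize Real.log ((Q u).1 w / q) = y
      conv_rhs => rw [this]
      ring

lemma directCost_mixOutput (P : stdSimplex ℝ U) (Q : Channel U W) (d : U → W → ℝ) (a : ℝ)
    (ha0 : 0 ≤ a) (ha1 : a ≤ 1) :
    directCost P d (mixOutput P Q a ha0 ha1) =
      (1 - a) * directCost P d Q + a * directCost P d fun _ => outputDist P Q := by
  simp_rw [directCost, Finset.mul_sum, ← Finset.sum_add_distrib, mixOutput_apply]
  refine Finset.sum_congr rfl fun u _ => Finset.sum_congr rfl fun w _ => ?_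
  simp only [outputDist]
  ring

/-- Every test channel has a perturbation of nearly the same cost whose rate is strictly smaller
than a given positive bound. -/
lemma exists_channel_natInfo_lt (P : stdSimplex ℝ U) (Q : Channel U W) (d : U → W → ℝ) {r b : ℝ}
    (hr : 0 < r) (hQ : natInfo P Q ≤ r) (hb : directCost P d Q < b) :
    ∃ Q' : Channel U W, natInfo P Q' < r ∧ directCost P d Q' < b := by
  set D' := directCost P d fun _ => outputDist P Q with hD'
  have hlim : Tendsto (fun a : ℝ => (1 - a) * directCost P d Q + a * D') (𝓝[>] 0)
      (𝓝 ((1 - 0) * directCost P d Q + 0 * D')) :=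
    (Continuous.tendsto (by fun_prop) 0).mono_left nhdsWithin_le_nhds
  rw [sub_zero, one_mul, zero_mul, add_zero] at hlim
  obtain ⟨a, hab, ha0, ha1⟩ := ((hlim.eventually_lt_const hb).and
    (Ioo_mem_nhdsGT (zero_lt_one (α := ℝ)))).exists
  refine ⟨mixOutput P Q a ha0.le ha1.le, ?_, ?_⟩
  · refine (natInfo_mixOutput_le P Q a ha0.le ha1.le).trans_lt ?_
    have h1 := mul_le_mul_of_nonneg_left hQ (sub_nonneg.2 ha1.le)
    have h2 := mul_pos ha0 hr
    linarith
  · rwa [directCost_mixOutput]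

/-- A channel without mutual information has a constant output law on the support of the source. -/
lemma channel_eq_outputLaw_of_natInfo_le_zero (P : stdSimplex ℝ U) (Q : Channel U W)
    (hQ : natInfo P Q ≤ 0) (u : U) (w : W) : P.1 u * (Q u).1 w = P.1 u * outputLaw P Q w := by
  -- The corrections in `klFun` cancel on summation, so mutual information is a sum of nonnegative
  -- terms; if the sum is at most zero, each term vanishes.
  have hterm : ∀ u w, P.1 u * outputLaw P Q w *
      InformationTheory.klFun ((Q u).1 w / outputLaw P Q w) =
      P.1 u * (Q u).1 w * Real.log ((Q u).1 w / outputLaw P Q w) +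
        (P.1 u * outputLaw P Q w - P.1 u * (Q u).1 w) := fun u w => by
    rcases (outputLaw_nonneg P Q w).eq_or_lt with h | h
    · have h0 : P.1 u * (Q u).1 w = 0 := by
        by_contra hne
        exact (outputLaw_pos P Q (lt_of_le_of_ne (mul_nonneg (P.2.1 u) ((Q u).2.1 w))
          (Ne.symm hne))).ne h
      rw [h0, ← h]
      simp
    · rw [InformationTheory.klFun]
      have hne := h.ne'
      field_simp
      ring
  have hnn : ∀ u w, 0 ≤ P.1 u * outputLaw P Q w *
      InformationTheory.klFun ((Q u).1 w / outputLaw P Q w) := fun u w =>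
    mul_nonneg (mul_nonneg (P.2.1 u) (outputLaw_nonneg P Q w))
      (InformationTheory.klFun_nonneg (div_nonneg ((Q u).2.1 w) (outputLaw_nonneg P Q w)))
  have hsum : ∑ u, ∑ w, P.1 u * outputLaw P Q w *
      InformationTheory.klFun ((Q u).1 w / outputLaw P Q w) ≤ 0 := by
    simp_rw [hterm, Finset.sum_add_distrib, Finset.sum_sub_distrib, ← Finset.mul_sum,
      sum_outputLaw, (Q _).2.2, sub_self, add_zero]
    exact hQ
  have h0 := (Finset.sum_eq_zero_iff_of_nonneg fun u _ => Finset.sum_nonneg fun w _ => hnn u w).1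
    (le_antisymm hsum (Finset.sum_nonneg fun u _ => Finset.sum_nonneg fun w _ => hnn u w)) u
    (Finset.mem_univ u)
  have h1 := (Finset.sum_eq_zero_iff_of_nonneg fun w _ => hnn u w).1 h0 w (Finset.mem_univ w)
  rcases mul_eq_zero.1 h1 with h | h
  · rcases mul_eq_zero.1 h with h | h
    · simp [h]
    · have := hterm u w
      rw [h]
      by_contra hne
      rw [mul_zero] at hne
      exact (outputLaw_pos P Q (lt_of_le_of_ne (mul_nonneg (P.2.1 u) ((Q u).2.1 w))
        (Ne.symm hne))).ne' h
  · rw [InformationTheory.klFun_eq_zero_iff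
      (div_nonneg ((Q u).2.1 w) (outputLaw_nonneg P Q w))] at h
    rw [eq_of_div_eq_one h]

/-- Without communication, the cost of the best constant reproduction is achieved. -/
lemma gammaN_le_of_natInfo_le_zero [Nonempty V] (P : stdSimplex ℝ U) (c : U → V → ℝ) {R₁ R₂ : ℝ}
    (Q : Channel U W) (f : W → V) (hQ : natInfo P Q ≤ 0) {n : ℕ} (hn : 0 < n) :
    gammaN P c c c R₁ R₂ n ≤ directCost P (fun u w => c u (f w)) Q := by
  have hn' : (n : ℝ) ≠ 0 := by exact_mod_cast hn.ne'
  obtain ⟨v, hv⟩ := Finite.exists_min fun v => ∑ u, P.1 u * c u v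
  have hcode := gammaN_le_of_code P c (n := n) (R₁ := R₁) (R₂ := R₂) one_pos
    Nat.one_le_two_pow Nat.one_le_two_pow (fun _ => 0) fun _ _ => v
  have hconst : ∑ u : Fin n → U, (∏ t, P.1 (u t)) * (1 / (n : ℝ) * ∑ t, c (u t) v) =
      ∑ a, P.1 a * c a v := by
    simp_rw [mul_left_comm _ (1 / (n : ℝ)), ← Finset.mul_sum]
    simp_rw [Finset.mul_sum (s := (Finset.univ : Finset (Fin n)))]
    rw [Finset.sum_comm]
    simp_rw [sum_prod_law_mul P.1 P.2.2 fun a => c a v]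
    rw [Finset.sum_const, Finset.card_univ, Fintype.card_fin, nsmul_eq_mul]
    field_simp
  refine (hcode.trans_eq hconst).trans ?_
  -- By independence the cost is an average over `w` of the costs of the constant reproductions `f
  -- w`.
  simp_rw [directCost, channel_eq_outputLaw_of_natInfo_le_zero P Q hQ]
  rw [Finset.sum_comm]
  calc _ = ∑ w, outputLaw P Q w * ∑ a, P.1 a * c a v := by
        rw [← Finset.sum_mul, sum_outputLaw, one_mul]
    _ ≤ ∑ w, outputLaw P Q w * ∑ a, P.1 a * c a (f w) :=
        Finset.sum_le_sum fun w _ => mul_le_mul_of_nonneg_left (hv (f w)) (outputLaw_nonneg P Q w)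
    _ = _ := by
        simp_rw [Finset.mul_sum]
        refine Finset.sum_congr rfl fun w _ => Finset.sum_congr rfl fun u _ => by ring

lemma eventually_gammaN_lt_of_gammaC_lt [Nonempty V] [Nonempty W] (P : stdSimplex ℝ U)
    (c : U → V → ℝ) {R₁ R₂ : ℝ} (hR₁ : 0 ≤ R₁) (hR₂ : 0 ≤ R₂) {b : ℝ}
    (hb : gammaC W P c c R₁ R₂ < b) : ∀ᶠ n : ℕ in atTop, gammaN P c c c R₁ R₂ n < b := by
  obtain ⟨_, ⟨Q, hQ, rfl⟩, -, hlt⟩ := (isGLB_gammaC P c hR₁ hR₂).exists_between hb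
  obtain ⟨T, hT⟩ := exists_singleWorst_eq P c Q
  obtain ⟨f, hf⟩ := exists_function_directCost_le P c Q T
  have hfb : directCost P (fun u w => c u (f w)) Q < b := hf.trans_lt (hT ▸ hlt)
  rw [targets, Set.mem_ofPred_eq, mutualInfo_eq, ge_iff_le,
    div_le_iff₀ (Real.log_pos one_lt_two)] at hQ
  -- At rate zero no channel has information strictly below the rate, so the random coding argument
  -- is unavailable.
  rcases (le_min hR₁ hR₂).eq_or_lt with h | h
  · rw [← h, zero_mul] at hQ
    filter_upwards [eventually_gt_atTop 0] with n hn
    exact (gammaN_le_of_natInfo_le_zero P c Q f hQ hn).trans_lt hfb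
  · obtain ⟨Q', hQ', hb'⟩ := exists_channel_natInfo_lt P Q _
      (mul_pos h (Real.log_pos one_lt_two)) hQ hfb
    exact eventually_gammaN_lt P c Q' f hQ' hb'

end Achievability

end CascadeCoding

end

theorem theorem1 {U V W : Type*} [Fintype U] [Fintype V] [Nonempty V] [Fintype W]
    (hW : min (Fintype.card U + 1) (Fintype.card V) ≤ Fintype.card W)
    (P : stdSimplex ℝ U) (c₁ c₂ c₃ : U → V → ℝ) (h₁₂ : c₁ = c₂) (h₂₃ : c₂ = c₃)
    (R₁ R₂ : ℝ) (hR₁ : 0 ≤ R₁) (hR₂ : 0 ≤ R₂) :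
    -- the maxima and infima in the definitions of the two optimal costs are genuine
    (∀ n : ℕ, 0 < n →
      (∀ σ : CascadeCoding.EncStrat U n R₁,
        IsGreatest (CascadeCoding.encoderCosts R₂ P c₁ c₂ c₃ σ)
          (CascadeCoding.worstCost R₂ P c₁ c₂ c₃ σ)) ∧
      IsGLB (Set.range fun σ : CascadeCoding.EncStrat U n R₁ =>
          CascadeCoding.worstCost R₂ P c₁ c₂ c₃ σ)
        (CascadeCoding.gammaN P c₁ c₂ c₃ R₁ R₂ n)) ∧
    (∀ Q ∈ CascadeCoding.targets W P R₁ R₂,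
      IsGreatest (CascadeCoding.singleCosts P c₁ c₃ Q)
        (CascadeCoding.singleWorst P c₁ c₃ Q)) ∧
    IsGLB ((fun Q => CascadeCoding.singleWorst P c₁ c₃ Q) '' CascadeCoding.targets W P R₁ R₂)
      (CascadeCoding.gammaC W P c₁ c₃ R₁ R₂) ∧
    -- the limit and the infimum over the block lengths are the single-letter optimal cost
    Tendsto (fun n : ℕ => CascadeCoding.gammaN P c₁ c₂ c₃ R₁ R₂ n) atTop
      (𝓝 (CascadeCoding.gammaC W P c₁ c₃ R₁ R₂)) ∧
    IsGLB ((fun n : ℕ => CascadeCoding.gammaN P c₁ c₂ c₃ R₁ R₂ n) '' {n : ℕ | 0 < n})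
      (CascadeCoding.gammaC W P c₁ c₃ R₁ R₂) := by
  subst h₁₂ h₂₃
  have : Nonempty W := by
    rw [← Fintype.card_pos_iff]
    exact (lt_min (Nat.succ_pos _) Fintype.card_pos).trans_le hW
  have hle : ∀ n : ℕ, 0 < n →
      CascadeCoding.gammaC W P c₁ c₁ R₁ R₂ ≤ CascadeCoding.gammaN P c₁ c₁ c₁ R₁ R₂ n :=
    fun n hn => CascadeCoding.le_gammaN P c₁
      (CascadeCoding.gammaC_le_longRunCost hW P c₁ hR₁ hR₂ hn)
  have hlim : Tendsto (fun n : ℕ => CascadeCoding.gammaN P c₁ c₁ c₁ R₁ R₂ n) atTop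
      (𝓝 (CascadeCoding.gammaC W P c₁ c₁ R₁ R₂)) := by
    refine tendsto_order.2 ⟨fun b hb => ?_, fun b hb =>
      CascadeCoding.eventually_gammaN_lt_of_gammaC_lt P c₁ hR₁ hR₂ hb⟩
    -- Block length zero is excluded: its cost is an empty sum, unrelated to the single-letter
    -- value.
    filter_upwards [eventually_gt_atTop 0] with n hn
    exact hb.trans_le (hle n hn)
  refine ⟨fun n _ => ⟨CascadeCoding.isGreatest_worstCost P c₁, CascadeCoding.isGLB_gammaN P c₁⟩,
    fun Q _ => CascadeCoding.isGreatest_singleWorst P c₁ Q,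
    CascadeCoding.isGLB_gammaC P c₁ hR₁ hR₂, hlim, ?_, fun b hb => ?_⟩
  · rintro _ ⟨n, hn, rfl⟩
    exact hle n hn
  · refine ge_of_tendsto hlim ?_
    filter_upwards [eventually_gt_atTop 0] with n hn
    exact hb ⟨n, hn, rfl⟩
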